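/- **Theorem 4.2.** Let $\bar\omega(x)=\frac{1}{4\pi}e^{-|x|^2/4}$ be the Gaussian vortex on $\mathbb{R}^2$, with radial profile $\omega_*(r)=\frac{1}{4\pi}e^{-r^2/4}$. Define the radial weight $\mathcal{A}$ on $\mathbb{R}^2$ by $$\mathcal{A}(x)=A(|x|),\qquad A(r)=-\frac{1}{r\,\omega_*'(r)}\int_0^r s\,\omega_*(s)\,ds\quad(r>0),\qquad A(0)=-\frac{\omega_*(0)}{2\,\omega_*''(0)}=1,$$ that is, $\mathcal{A}(x)=4|x|^{-2}\bigl(e^{|x|^2/4}-1\bigr)$ for $x\neq0$, and let $$\mathcal{B}(x)=1+\mathcal{A}(x)-\frac{x\cdot\nabla\mathcal{A}(x)}{|x|^2}\qquad(x\neq0).$$ Consider the spaces of real-valued functions $$X=\Bigl\{\omega\in L^2(\mathbb{R}^2):\ \|\omega\|_X^2:=\int_{\mathbb{R}^2}\mathcal{A}\,\omega^2\,dx<\infty\Bigr\},$$ $$\mathcal{X}_1=\Bigl\{\omega\in X:\ \int_{\mathbb{R}^2}\omega\,dx=0,\ \int_{\mathbb{R}^2}x_j\,\omega\,dx=0\ \text{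 for } j=1,2\Bigr\},$$ $$Z=\Bigl\{\omega\in H^1(\mathbb{R}^2):\ \mathcal{A}^{1/2}\omega\in L^2(\mathbb{R}^2),\ \mathcal{A}^{1/2}\nabla\omega\in L^2(\mathbb{R}^2)\Bigr\},$$ where $\nabla\omega$ is the weak gradient. Then for every $\omega\in Z\cap\mathcal{X}_1$ the function $\mathcal{A}|\nabla\omega|^2-\mathcal{B}\omega^2$ is integrable on $\mathbb{R}^2$, and the quadratic form $$Q(\omega)=\int_{\mathbb{R}^2}\Bigl(\mathcal{A}(x)|\nabla\omega(x)|^2-\mathcal{B}(x)\,\omega(x)^2\Bigr)dx$$ is coercive on $Z\cap\mathcal{X}_1$: there exists a constant $\delta>0$ such that $$Q(\omega)\ \ge\ \delta\,\|\omega\|_X^2=\delta\int_{\mathbb{R}^2}\mathcal{A}(x)\,\omega(x)^2\,dx\qquad\text{for all }\omega\in Z\cap\mathcal{X}_1 .$$ -/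

import Mathlib

noncomputable section

namespace OseenVortex

open MeasureTheory

/-- The Euclidean plane. -/
abbrev Plane : Type := EuclideanSpace ℝ (Fin 2)

/-- Radial profile of the Gaussian (Lamb-Oseen) vortex. -/
def gaussProfile (r : ℝ) : ℝ := 1 / (4 * Real.pi) * Real.exp (-r ^ 2 / 4)

/-- The radial weight `A = -ψ' / ω'` of a radially decreasing vortex with vorticity profile `ω`,
where `ψ' r = r⁻¹ ∫₀ʳ s ω(s) ds` is the derivative of its stream profile; at the origin it takes
the limiting value `-ω(0) / (2 ω''(0))`. -/
def weightProfile (ω : ℝ → ℝ) (r : ℝ) : ℝ :=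
  if r = 0 then -ω 0 / (2 * iteratedDeriv 2 ω 0)
  else -(1 / (r * deriv ω r)) * ∫ s in (0 : ℝ)..r, s * ω s

/-- The weight `𝒜` on the plane associated with the Gaussian vortex. -/
def calA (x : Plane) : ℝ := weightProfile gaussProfile ‖x‖

/-- The weight `ℬ = 1 + 𝒜 - (x · ∇𝒜) / |x|²` (only its values for `x ≠ 0` matter). -/
def calB (x : Plane) : ℝ := 1 + calA x - inner ℝ x (gradient calA x) / ‖x‖ ^ 2

/-- `g` is the gradient of `ω` on the plane in the sense of distributions: both are locally
integrable, and `∫ ω ∂ⱼφ = -∫ φ gⱼ` for every smooth compactly supported `φ`. -/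
def HasWeakGradient (ω : Plane → ℝ) (g : Plane → Plane) : Prop :=
  LocallyIntegrable ω volume ∧ LocallyIntegrable g volume ∧
    ∀ φ : Plane → ℝ, ContDiff ℝ ((⊤ : ℕ∞) : WithTop ℕ∞) φ → HasCompactSupport φ →
      ∀ j : Fin 2,
        ∫ x, ω x * fderiv ℝ φ x (EuclideanSpace.single j 1) = -∫ x, φ x * g x j

/-- The weighted space `X = {ω ∈ L² : 𝒜^{1/2} ω ∈ L²}` (elements are represented by functions). -/
def spaceX : Set (Plane → ℝ) :=
  {ω | MemLp ω 2 volume ∧ MemLp (fun x => √(calA x) * ω x) 2 volume}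

/-- `‖ω‖_X² = ∫ 𝒜 ω²`. -/
def normXSq (ω : Plane → ℝ) : ℝ := ∫ x, calA x * ω x ^ 2

/-- The subspace of `X` of functions with zero mass and zero first moments. -/
def momentSpace : Set (Plane → ℝ) :=
  {ω | ω ∈ spaceX ∧ ∫ x, ω x = 0 ∧ ∀ j : Fin 2, ∫ x, x j * ω x = 0}

/-- The weighted Sobolev space `Z = {ω ∈ H¹ : 𝒜^{1/2} ω ∈ L², 𝒜^{1/2} ∇ω ∈ L²}`. -/
def spaceZ : Set (Plane → ℝ) :=
  {ω | MemLp ω 2 volume ∧ MemLp (fun x => √(calA x) * ω x) 2 volume ∧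
    ∃ g : Plane → Plane, HasWeakGradient ω g ∧ MemLp g 2 volume ∧
      MemLp (fun x => √(calA x) • g x) 2 volume}

/-- The integrand `𝒜 |∇ω|² - ℬ ω²`, where `g` stands for `∇ω`. -/
def densityQ (ω : Plane → ℝ) (g : Plane → Plane) (x : Plane) : ℝ :=
  calA x * ‖g x‖ ^ 2 - calB x * ω x ^ 2

/-- The diffusive quadratic form `Q(ω) = ∫ (𝒜 |∇ω|² - ℬ ω²)`, where `g` stands for `∇ω`. -/
def formQ (ω : Plane → ℝ) (g : Plane → Plane) : ℝ := ∫ x, densityQ ω g x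

theorem hasDerivAt_gaussProfile (r : ℝ) :
    HasDerivAt gaussProfile (-(r / 2) * gaussProfile r) r := by
  unfold gaussProfile
  have h : HasDerivAt (fun r : ℝ => -r ^ 2 / 4) (-(2 * r) / 4) r := by
    have h1 := ((hasDerivAt_pow 2 r).neg).div_const 4
    simpa using h1
  have h2 := (h.exp).const_mul (1 / (4 * Real.pi))
  refine h2.congr_deriv ?_
  ring

theorem weightProfile_gauss_zero : weightProfile gaussProfile 0 = 1 := by
  have h0 : gaussProfile 0 ≠ 0 := by
    unfold gaussProfile; positivity
  have hd : deriv gaussProfile = fun r => -(r / 2) * gaussProfile r :=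
    funext fun r => (hasDerivAt_gaussProfile r).deriv
  have h2 : iteratedDeriv 2 gaussProfile 0 = -(1 / 2) * gaussProfile 0 := by
    rw [iteratedDeriv_succ, iteratedDeriv_one, hd]
    have h1 : HasDerivAt (fun r : ℝ => -(r / 2)) (-(1 / 2)) 0 :=
      ((hasDerivAt_id (0 : ℝ)).div_const 2).neg
    have h3 := h1.mul (hasDerivAt_gaussProfile 0)
    refine (h3.congr_deriv ?_).deriv
    simp
  rw [weightProfile, if_pos rfl, h2]
  field_simp

/-- For the Gaussian vortex, `A(r) = (eˢ - 1) / s` with `s = r² / 4`. -/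
theorem weightProfile_gauss {r : ℝ} (hr : r ≠ 0) :
    weightProfile gaussProfile r = (Real.exp (r ^ 2 / 4) - 1) / (r ^ 2 / 4) := by
  have hI : ∫ s in (0 : ℝ)..r, s * gaussProfile s = -2 * gaussProfile r - -2 * gaussProfile 0 := by
    refine intervalIntegral.integral_eq_sub_of_hasDerivAt (f := fun s => -2 * gaussProfile s)
      (fun s _ => ?_) ?_
    · exact ((hasDerivAt_gaussProfile s).const_mul (-2)).congr_deriv (by ring)
    · apply Continuous.intervalIntegrable
      unfold gaussProfile
      fun_prop
  rw [weightProfile, if_neg hr, hI, (hasDerivAt_gaussProfile r).deriv]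
  have he : Real.exp (-r ^ 2 / 4) = (Real.exp (r ^ 2 / 4))⁻¹ := by
    rw [← Real.exp_neg]; ring_nf
  have hp := Real.pi_ne_zero
  have hx := (Real.exp_pos (r ^ 2 / 4)).ne'
  simp only [gaussProfile, he]
  norm_num
  field_simp
  ring

theorem calA_eq {x : Plane} (hx : x ≠ 0) :
    calA x = (Real.exp (‖x‖ ^ 2 / 4) - 1) / (‖x‖ ^ 2 / 4) :=
  weightProfile_gauss (norm_ne_zero_iff.2 hx)

theorem calA_zero : calA 0 = 1 := by
  rw [calA, norm_zero, weightProfile_gauss_zero]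

/-- `ℬ(x) = (eˢ (1 + s) - 1 - 2 s) / (2 s²) + 1` with `s = |x|² / 4`. -/
theorem calB_eq {x : Plane} (hx : x ≠ 0) :
    calB x = (Real.exp (‖x‖ ^ 2 / 4) * (1 + ‖x‖ ^ 2 / 4) - 1 - 2 * (‖x‖ ^ 2 / 4)) /
      (2 * (‖x‖ ^ 2 / 4) ^ 2) + 1 := by
  have hn : ‖x‖ ^ 2 / 4 ≠ 0 := by
    have := norm_pos_iff.2 hx
    positivity
  have hs : HasFDerivAt (fun y : Plane => ‖y‖ ^ 2 / 4) ((1 / 2 : ℝ) • innerSL ℝ x) x := by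
    have h := (hasStrictFDerivAt_norm_sq x).hasFDerivAt.const_mul (1 / 4 : ℝ)
    refine (h.congr_fderiv ?_).congr_of_eventuallyEq (.of_forall fun y => by ring)
    ext y
    simp
    ring
  have hq : HasDerivAt (fun s : ℝ => (Real.exp s - 1) / s)
      ((Real.exp (‖x‖ ^ 2 / 4) * (‖x‖ ^ 2 / 4) - (Real.exp (‖x‖ ^ 2 / 4) - 1) * 1) /
        (‖x‖ ^ 2 / 4) ^ 2) (‖x‖ ^ 2 / 4) :=
    ((Real.hasDerivAt_exp _).sub_const 1).div (hasDerivAt_id _) hn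
  have hc := hq.comp_hasFDerivAt x hs
  have hA := hc.congr_of_eventuallyEq (f₁ := calA)
    ((isOpen_ne.eventually_mem hx).mono fun y hy => calA_eq hy)
  have hg : inner ℝ x (gradient calA x) = fderiv ℝ calA x x := by
    rw [gradient, real_inner_comm, InnerProductSpace.toDual_symm_apply]
  rw [calB, hg, hA.fderiv, calA_eq hx]
  have hn' : ‖x‖ ≠ 0 := norm_ne_zero_iff.2 hx
  simp only [smul_apply, smul_eq_mul, innerSL_apply_apply,
    real_inner_self_eq_norm_sq]
  field_simp
  ring

end OseenVortex

end

/-! With s = |x|²/4 the weights are 𝒜 = (eˢ - 1)/s and ℬ = 1 + 𝒜/2 + (𝒜 - 1)/(2s). They are radial,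
so the form splits over angular Fourier modes into one-dimensional problems, each settled by a
calibration: an explicit quadratic expression in the radial coefficient u and, for modes zero and
one, in a partial moment m accumulated from the origin. Its r-derivative lies below the integrand of
Q(ω) - ‖ω‖_X²/1000; the difference is a square plus nonnegative multiples of u² and m². Integration
over [0, R], with R bounding the support, leaves only boundary values. They vanish at 0, and also at
R, since u(R) = 0 and m(R) is a multiple of a moment of ω: this is where the constraints enter.

Mode zero (`exists_hasDerivAt_potZero_le`) becomes polynomial in 1 - e⁻ˢ once ℬ is bounded by
`potential_le`. In mode one (`exists_hasDerivAt_potOne_le`) the form degenerates exactly on the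
translation modes ∂ⱼω̄, of profile √s e⁻ˢ; a small term in the first moment opens the gap. The
higher modes are treated together through `bessel_circle` and `wirtinger_circle`, and their larger
angular energy leaves room (`exists_hasDerivAt_potTwo_le`).

This gives δ = 1/1000 for compactly supported C¹ functions (`integral_coerciveDensity_nonneg`).
Cutoff and mollification approximate in the weighted norms, and ℬ ≤ 2𝒜 makes Q continuous there.
Since 𝒜 dominates (1 + |x|)⁶, the moments are continuous too, so approximants can be corrected to
have zero moments at vanishing cost (`exists_isTestApprox_moments`). -/

noncomputable section

namespace OseenVortex

/-! ### Radial profiles of the two weights -/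

section

open MeasureTheory

/-- The weight as a function of `s = |x|² / 4`: `profA s = (eˢ - 1) / s`, and `1` at the origin. -/
def profA (s : ℝ) : ℝ := dslope Real.exp 0 s

/-- The potential `ℬ` as a function of `s = |x|² / 4`. -/
def profB (s : ℝ) : ℝ := 1 + profA s / 2 + (profA s - 1) / (2 * s)

theorem mul_profA (s : ℝ) : s * profA s = Real.exp s - 1 := by
  have := sub_smul_dslope Real.exp 0 s
  simpa [profA] using this

theorem profA_zero : profA 0 = 1 := by simp [profA]

theorem profA_of_ne {s : ℝ} (hs : s ≠ 0) : profA s = (Real.exp s - 1) / s := by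
  rw [eq_div_iff hs, mul_comm, mul_profA]

theorem continuous_profA : Continuous profA := by
  rw [← continuousOn_univ]
  exact (continuousOn_dslope Filter.univ_mem).2
    ⟨Real.continuous_exp.continuousOn, Real.differentiable_exp 0⟩

theorem hasDerivAt_profA {s : ℝ} (hs : s ≠ 0) :
    HasDerivAt profA ((Real.exp s - profA s) / s) s := by
  have h : HasDerivAt (fun s : ℝ => (Real.exp s - 1) / s)
      ((Real.exp s * s - (Real.exp s - 1) * 1) / s ^ 2) s :=
    ((Real.hasDerivAt_exp _).sub_const 1).div (hasDerivAt_id _) hs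
  refine (h.congr_of_eventuallyEq
    ((isOpen_ne.eventually_mem hs).mono fun y hy => profA_of_ne hy)).congr_deriv ?_
  rw [profA_of_ne hs]
  field_simp

theorem profA_cubic_le {s : ℝ} (hs : 0 ≤ s) : 1 + s / 2 + s ^ 2 / 6 + s ^ 3 / 24 ≤ profA s := by
  rcases hs.eq_or_lt with rfl | h
  · simp [profA_zero]
  · rw [profA_of_ne h.ne', le_div_iff₀ h]
    have := Real.sum_le_exp_of_nonneg hs 5
    simp [Finset.sum_range_succ, Nat.factorial] at this
    nlinarith [this]

theorem one_le_profA {s : ℝ} (hs : 0 ≤ s) : 1 ≤ profA s := by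
  have := profA_cubic_le hs
  have : 0 ≤ s / 2 + s ^ 2 / 6 + s ^ 3 / 24 := by positivity
  linarith

theorem profB_nonneg {s : ℝ} (hs : 0 ≤ s) : 0 ≤ profB s := by
  have h := one_le_profA hs
  have : 0 ≤ (profA s - 1) / (2 * s) := div_nonneg (by linarith) (by linarith)
  unfold profB
  linarith

/-- This comparison makes the ℬ-term of the form finite and continuous in the norm of X. It reduces
to eˢ(1 - s) ≤ 1, that is, 1 - s ≤ e⁻ˢ. -/
theorem profB_le {s : ℝ} (hs : 0 < s) : profB s ≤ 2 * profA s := by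
  have h := one_le_profA hs.le
  have h2 : (profA s - 1) / (2 * s) ≤ profA s / 2 := by
    rw [div_le_iff₀ (by positivity)]
    have h1 := mul_profA s
    have h3 : 1 - s ≤ Real.exp (-s) := by linarith [Real.add_one_le_exp (-s)]
    have h4 : Real.exp s * (1 - s) ≤ 1 := by
      calc Real.exp s * (1 - s) ≤ Real.exp s * Real.exp (-s) := by gcongr
        _ = 1 := by rw [← Real.exp_add]; simp
    have h5 : s * (profA s - 1) ≤ s * (profA s / 2 * (2 * s)) := by nlinarith
    exact le_of_mul_le_mul_left h5 hs
  unfold profB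
  linarith

theorem calA_eq_profA (x : Plane) : calA x = profA (‖x‖ ^ 2 / 4) := by
  by_cases hx : x = 0
  · simp [hx, calA_zero, profA_zero]
  · have hn : ‖x‖ ^ 2 / 4 ≠ 0 := by
      have := norm_pos_iff.2 hx
      positivity
    rw [calA_eq hx, profA_of_ne hn]

theorem calB_eq_profB {x : Plane} (hx : x ≠ 0) : calB x = profB (‖x‖ ^ 2 / 4) := by
  have hn : ‖x‖ ^ 2 / 4 ≠ 0 := by
    have := norm_pos_iff.2 hx
    positivity
  rw [calB_eq hx, profB, profA_of_ne hn]
  field_simp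
  ring

theorem continuous_calA : Continuous calA := by
  have : calA = fun x => profA (‖x‖ ^ 2 / 4) := funext calA_eq_profA
  rw [this]
  exact continuous_profA.comp (by fun_prop)

theorem one_le_calA (x : Plane) : 1 ≤ calA x := by
  rw [calA_eq_profA]
  exact one_le_profA (by positivity)

theorem calA_pos (x : Plane) : 0 < calA x := zero_lt_one.trans_le (one_le_calA x)

theorem ae_ne_zero : ∀ᵐ x : Plane, x ≠ 0 := by
  simp [ae_iff]

theorem measurable_profB : Measurable profB := by
  have := continuous_profA.measurable
  unfold profB
  fun_prop

theorem aemeasurable_calB : AEMeasurable calB volume :=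
  ⟨fun x => profB (‖x‖ ^ 2 / 4), measurable_profB.comp (by fun_prop),
    ae_ne_zero.mono fun _ hx => calB_eq_profB hx⟩

theorem calB_nonneg {x : Plane} (hx : x ≠ 0) : 0 ≤ calB x := by
  rw [calB_eq_profB hx]
  exact profB_nonneg (by positivity)

theorem calB_le {x : Plane} (hx : x ≠ 0) : calB x ≤ 2 * calA x := by
  have := norm_pos_iff.2 hx
  rw [calB_eq_profB hx, calA_eq_profA]
  exact profB_le (by positivity)

end

/-! ### One-dimensional calibrations for the angular sectors -/

section

open MeasureTheory

/-- With x = 1 - e⁻ˢ one has s = -log(1 - x), and the left side is the [3/3] Padé approximant of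
this logarithm at x = 0. The difference vanishes at s = 0 and has s-derivative 9x⁶/D² ≥ 0. -/
theorem pade_le_self {s : ℝ} (hs : 0 ≤ s) :
    (1 - Real.exp (-s)) * (60 - 60 * (1 - Real.exp (-s)) + 11 * (1 - Real.exp (-s)) ^ 2) /
      (3 * (2 - (1 - Real.exp (-s))) * (10 - 10 * (1 - Real.exp (-s)) + (1 - Real.exp (-s)) ^ 2))
      ≤ s := by
  set D : ℝ → ℝ := fun s => 3 * (2 - (1 - Real.exp (-s))) *
    (10 - 10 * (1 - Real.exp (-s)) + (1 - Real.exp (-s)) ^ 2) with hD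
  set N : ℝ → ℝ := fun s => (1 - Real.exp (-s)) *
    (60 - 60 * (1 - Real.exp (-s)) + 11 * (1 - Real.exp (-s)) ^ 2) with hN
  have hDpos : ∀ s, 0 < D s := fun s => by
    have h := Real.exp_pos (-s)
    have : D s = 3 * (1 + Real.exp (-s)) * (1 + 8 * Real.exp (-s) + Real.exp (-s) ^ 2) := by
      simp only [hD]; ring
    rw [this]; positivity
  have hx : ∀ s, HasDerivAt (fun s : ℝ => 1 - Real.exp (-s)) (Real.exp (-s)) s := fun s => by
    simpa using ((hasDerivAt_neg s).exp).const_sub 1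
  have hderiv : ∀ s, HasDerivAt (fun s => s - N s / D s)
      (9 * (1 - Real.exp (-s)) ^ 6 / D s ^ 2) s := fun s => by
    have h1 := (hx s).mul ((((hx s).const_mul 60).const_sub 60).add (((hx s).pow 2).const_mul 11))
    have h2 := (((hx s).const_sub 2).const_mul 3).mul
      ((((hx s).const_mul 10).const_sub 10).add ((hx s).pow 2))
    have h3 := (hasDerivAt_id s).sub (h1.div h2 (hDpos s).ne')
    refine h3.congr_deriv ?_
    have hne := (hDpos s).ne'
    simp only [Pi.add_apply, Pi.mul_apply, Pi.pow_apply]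
    change _ - _ / D s ^ 2 = _
    rw [eq_div_iff (by positivity), sub_mul, div_mul_cancel₀ _ (by positivity)]
    simp only [hD]
    norm_num
    ring
  have hmono : Monotone (fun s => s - N s / D s) :=
    monotone_of_hasDerivAt_nonneg hderiv fun s => by positivity
  have := hmono hs
  simp only [hN, hD] at this ⊢
  norm_num at this
  linarith

/-- The left side is e⁻ˢ(ℬ - 1 + 𝒜/1000). A majorant polynomial in x = 1 - e⁻ˢ turns mode zero into
a polynomial problem on 0 < x < 1. After multiplication by 2s² the claim is the sign of a quadratic
in s, checked at the Padé lower bound L and propagated to s ≥ L. -/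
theorem potential_le {s : ℝ} (hs : 0 < s) :
    (1 - Real.exp (-s) + s * (2 * (1 - Real.exp (-s)) - 1)) / (2 * s ^ 2)
      + 1 / 1000 * (1 - Real.exp (-s)) / s ≤
    77 / 100 - 17 / 50 * (1 - Real.exp (-s)) - 11 / 50 * (1 - Real.exp (-s)) ^ 2 := by
  have hL := pade_le_self hs.le
  have hy := Real.exp_pos (-s)
  have hx : 0 < 1 - Real.exp (-s) := by
    have : Real.exp (-s) < 1 := by simpa using (Real.exp_lt_exp.2 (by linarith : -s < 0))
    linarith
  set x := 1 - Real.exp (-s) with hxd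
  have hy' : 0 < 1 - x := by rw [hxd]; linarith
  set N := 60 - 60 * x + 11 * x ^ 2 with hN
  set D := 3 * (2 - x) * (10 - 10 * x + x ^ 2) with hD
  have hNp : 0 < N := by nlinarith [sq_nonneg (x - 1), mul_pos hx hy']
  have hDp : 0 < D := by
    have : 0 < 10 - 10 * x + x ^ 2 := by nlinarith [sq_nonneg x, mul_pos hx hy']
    have : 0 < 2 - x := by linarith
    rw [hD]; positivity
  set V := 77 / 100 - 17 / 50 * x - 11 / 50 * x ^ 2 with hV
  set L := x * N / D with hLd
  have hLp : 0 < L := by positivity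
  -- Here 1001/500 = 2 + 2/1000, the second summand coming from the coercivity constant.
  have key : (1001 / 500 * x - 1) * L + x ≤ 2 * V * L ^ 2 := by
    -- Bernstein form of degree six: all coefficients in the basis xᵏ(1 - x)⁶⁻ᵏ are positive.
    have h1 : 0 ≤ x * (684/5 * (1 - x)^6 + 5514/5 * x * (1 - x)^5 + 35109/25 * x^2 * (1 - x)^4
      + 5217/10 * x^3 * (1 - x)^3 + 7991/125 * x^4 * (1 - x)^2 + 21291/500 * x^5 * (1 - x)
      + 4377/500 * x^6) * x := by positivity
    have h2 : 2 * V * L ^ 2 - ((1001 / 500 * x - 1) * L + x) =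
      (x * (684/5 * (1 - x)^6 + 5514/5 * x * (1 - x)^5 + 35109/25 * x^2 * (1 - x)^4
      + 5217/10 * x^3 * (1 - x)^3 + 7991/125 * x^4 * (1 - x)^2 + 21291/500 * x^5 * (1 - x)
      + 4377/500 * x^6) * x) / D ^ 2 := by
      rw [eq_div_iff (by positivity), hLd]
      have : (2 * V * (x * N / D) ^ 2 - ((1001 / 500 * x - 1) * (x * N / D) + x)) * D ^ 2 =
        2 * V * x ^ 2 * N ^ 2 - ((1001 / 500 * x - 1) * x * N * D + x * D ^ 2) := by
        field_simp
      rw [this, hV, hN, hD]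
      ring
    have h3 := div_nonneg h1 (sq_nonneg D)
    linarith
  have hk : 1001 / 500 * x - 1 ≤ 2 * V * L := by
    have : (1001 / 500 * x - 1) * L ≤ (2 * V * L) * L := by nlinarith
    exact le_of_mul_le_mul_right this hLp
  have hVp : 0 ≤ V := by nlinarith
  -- For f(t) = 2Vt² - (1001x/500 - 1)t - x, f(s) - f(L) = (s - L)(2V(s + L) - (1001x/500 - 1)); the
  -- last factor is nonnegative by `hk`.
  have hfin : (1001 / 500 * x - 1) * s + x ≤ 2 * V * s ^ 2 := by
    nlinarith [mul_nonneg (sub_nonneg.2 hL)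
      (by nlinarith : 0 ≤ 2 * V * (s + L) - (1001 / 500 * x - 1))]
  have hs2 : (0:ℝ) < 2 * s ^ 2 := by positivity
  have : (x + s * (2 * x - 1)) / (2 * s ^ 2) + 1 / 1000 * x / s =
      ((1001 / 500 * x - 1) * s + x) / (2 * s ^ 2) := by
    field_simp
    ring
  rw [this, div_le_iff₀ hs2]
  linarith

/-- Another form of 𝒜 ≤ eˢ = 1 + s𝒜. -/
theorem mul_one_sub_le {s : ℝ} (hs : 0 ≤ s) : profA s * (1 - s) ≤ 1 := by
  rcases hs.eq_or_lt with rfl | h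
  · simp [profA_zero]
  · have h1 := mul_profA s
    have h3 : 1 - s ≤ Real.exp (-s) := by linarith [Real.add_one_le_exp (-s)]
    have h4 : Real.exp s * (1 - s) ≤ 1 := by
      calc Real.exp s * (1 - s) ≤ Real.exp s * Real.exp (-s) := by gcongr
        _ = 1 := by rw [← Real.exp_add]; simp
    have h5 : s * (profA s * (1 - s)) ≤ s * 1 := by nlinarith
    exact le_of_mul_le_mul_left h5 h

theorem hasDerivAt_sq_div_four (r : ℝ) : HasDerivAt (fun r : ℝ => r ^ 2 / 4) (r / 2) r := by
  refine ((hasDerivAt_pow 2 r).div_const 4).congr_deriv ?_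
  norm_num
  ring

/-- Potential function whose derivative bounds the radial (angular mode zero) part of the form from
below; `m` stands for the mass `∫ u ds` in a disc and `s = r² / 4`. -/
def potZero (s u m : ℝ) : ℝ :=
  2 * (-(Real.exp s - 1) * ((1 + (39 / 50 - (1 - Real.exp (-s)) / 10)) * u ^ 2
    + 2 * (51 / 50 - 17 / 50 * (1 - Real.exp (-s))) * u * m
    + (39 / 50 - (1 - Real.exp (-s)) / 10) * (51 / 50 - 17 / 50 * (1 - Real.exp (-s))) * m ^ 2)
    + (51 / 50 - 17 / 25 * (1 - Real.exp (-s))) * m ^ 2)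

/-- In the variable s the integrand is 2((eˢ - 1)u_s² - (ℬ + 𝒜/1000)u²), and m_s = u. Put x = 1 -
e⁻ˢ, P = 39/50 - x/10, R = 51/50 - 17x/50. Subtracting the derivative completes the square (eˢ -
1)(u_s + (1 + P)u + Rm)². The coefficient PR and the last coefficient R + (eˢ - 1)R_s = 51/50 -
17x/25 are such that no um term survives. -/
theorem exists_hasDerivAt_potZero_le {u m : ℝ → ℝ} {u' r : ℝ} (hr : 0 < r)
    (hu : HasDerivAt u u' r) (hm : HasDerivAt m (r / 2 * u r) r) :
    ∃ d, HasDerivAt (fun r => potZero (r ^ 2 / 4) (u r) (m r)) d r ∧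
      d ≤ r * (profA (r ^ 2 / 4) * u' ^ 2
        - (profB (r ^ 2 / 4) + 1 / 1000 * profA (r ^ 2 / 4)) * u r ^ 2) := by
  have hs := hasDerivAt_sq_div_four r
  have he := hs.exp
  have hx : HasDerivAt (fun r : ℝ => 1 - Real.exp (-(r ^ 2 / 4)))
      (Real.exp (-(r ^ 2 / 4)) * (r / 2)) r := by
    refine (hs.fun_neg.exp.const_sub 1).congr_deriv ?_
    ring
  have hP := (hx.div_const 10).const_sub (39 / 50)
  have hR := (hx.const_mul (17 / 50)).const_sub (51 / 50)
  have hT := (hx.const_mul (17 / 25)).const_sub (51 / 50)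
  have hd := (((he.sub_const 1).fun_neg.fun_mul ((((hP.const_add 1).fun_mul (hu.fun_pow 2)).fun_add
    (((hR.const_mul 2).fun_mul hu).fun_mul hm)).fun_add ((hP.fun_mul hR).fun_mul
      (hm.fun_pow 2)))).fun_add (hT.fun_mul (hm.fun_pow 2))).const_mul 2
  refine ⟨_, hd, ?_⟩
  have hs0 : 0 < r ^ 2 / 4 := by positivity
  have hpot := potential_le hs0
  have hy := Real.exp_pos (-(r ^ 2 / 4))
  have hy1 : Real.exp (-(r ^ 2 / 4)) < 1 := by
    simpa using (Real.exp_lt_exp.2 (by linarith : -(r ^ 2 / 4) < 0))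
  rw [profB, profA_of_ne hs0.ne']
  have hE : Real.exp (r ^ 2 / 4) = (Real.exp (-(r ^ 2 / 4)))⁻¹ := by
    rw [Real.exp_neg, inv_inv]
  rw [hE]
  generalize Real.exp (-(r ^ 2 / 4)) = y at *
  generalize u r = a at *
  generalize m r = b at *
  have hsq : 0 ≤ (y⁻¹ - 1) * (2 / r * u' + (1 + (39 / 50 - (1 - y) / 10)) * a
      + (51 / 50 - 17 / 50 * (1 - y)) * b) ^ 2 := by
    have : 1 ≤ y⁻¹ := (one_le_inv₀ hy).2 hy1.le
    exact mul_nonneg (by linarith) (sq_nonneg _)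
  -- Slack of `potential_le`. The next term is the u² coefficient left after ℬ is replaced by its
  -- majorant, in Bernstein form in y = e⁻ˢ.
  have hu2 : 0 ≤ y⁻¹ * (77 / 100 - 17 / 50 * (1 - y) - 11 / 50 * (1 - y) ^ 2 -
      ((1 - y + r ^ 2 / 4 * (2 * (1 - y) - 1)) / (2 * (r ^ 2 / 4) ^ 2)
      + 1 / 1000 * (1 - y) / (r ^ 2 / 4))) * a ^ 2 :=
    mul_nonneg (mul_nonneg (by positivity) (by linarith)) (sq_nonneg _)
  have hy1' : 0 ≤ 1 - y := by linarith
  have hu3 : 0 ≤ y⁻¹ * (1 / 100 * y ^ 3 + 26 / 625 * y ^ 2 * (1 - y) + 123 / 2500 * y * (1 - y) ^ 2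
      + 19 / 2500 * (1 - y) ^ 3) * a ^ 2 := by positivity
  have hm2 : 0 ≤ y⁻¹ * (3689 / 2500 * y ^ 3 + 323 / 250 * y ^ 2 * (1 - y)) * b ^ 2 := by
    positivity
  have hsum := mul_nonneg hr.le (add_nonneg (add_nonneg hsq hu2) (add_nonneg hu3 hm2))
  rw [← sub_nonneg]
  refine hsum.trans_eq ?_
  have hy0 := hy.ne'
  have hr0 := hr.ne'
  field_simp
  ring

/-- Potential function for the first angular modes; `m` stands for `∫ √s u ds` and `q = m / r`. -/
def potOne (s u q : ℝ) : ℝ :=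
  2 * (profA s * (1 / 2 - s) * u ^ 2
    - 4 * (1 / 100 * (1 + 4 * s) / (1 + s) ^ 2) * Real.exp s * u * q
    + 4 * (1 / 100 * (2 - 4 * s) / (1 + s) ^ 3) * Real.exp s * q ^ 2)

/-- Without moment terms and without the 1/1000, the difference is exactly the square (eˢ - 1)(u_s -
(1/(2s) - 1)u)², which vanishes on √s e⁻ˢ. The terms in β = (1 + 4s)/(100(1 + s)²) produce a gain
2βeˢu². The coefficient of q² contains dβ/ds because this cancels the um term. -/
theorem exists_hasDerivAt_potOne_le {u m : ℝ → ℝ} {u' r : ℝ} (hr : 0 < r)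
    (hu : HasDerivAt u u' r) (hm : HasDerivAt m (r ^ 2 / 4 * u r) r) :
    ∃ d, HasDerivAt (fun r => potOne (r ^ 2 / 4) (u r) (m r / r)) d r ∧
      d ≤ r * (profA (r ^ 2 / 4) * u' ^ 2 + profA (r ^ 2 / 4) / r ^ 2 * u r ^ 2
        - (profB (r ^ 2 / 4) + 1 / 1000 * profA (r ^ 2 / 4)) * u r ^ 2) := by
  have hs := hasDerivAt_sq_div_four r
  have hs0 : 0 < r ^ 2 / 4 := by positivity
  have he := hs.exp
  have hA : HasDerivAt (fun r : ℝ => profA (r ^ 2 / 4))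
      ((Real.exp (r ^ 2 / 4) - profA (r ^ 2 / 4)) / (r ^ 2 / 4) * (r / 2)) r :=
    (hasDerivAt_profA hs0.ne').comp r hs
  have hq := hm.fun_div (hasDerivAt_id' r) hr.ne'
  have h1 := hs.const_add 1
  have hb := ((((hs.const_mul 4).const_add 1).const_mul (1 / 100)).fun_div (h1.fun_pow 2)
    (by positivity)).const_mul 4
  have hb' := ((((hs.const_mul 4).const_sub 2).const_mul (1 / 100)).fun_div (h1.fun_pow 3)
    (by positivity)).const_mul 4
  have hd := ((((hA.fun_mul (hs.const_sub (1 / 2))).fun_mul (hu.fun_pow 2)).fun_sub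
    (((hb.fun_mul he).fun_mul hu).fun_mul hq)).fun_add
      ((hb'.fun_mul he).fun_mul (hq.fun_pow 2))).const_mul 2
  refine ⟨_, hd, ?_⟩
  have hA1 := one_le_profA hs0.le
  have hE : Real.exp (r ^ 2 / 4) = 1 + r ^ 2 / 4 * profA (r ^ 2 / 4) := by
    linarith [mul_profA (r ^ 2 / 4)]
  have hA5 : profA (r ^ 2 / 4) * (1 - r ^ 2 / 4) ≤ 1 := by
    have := mul_one_sub_le hs0.le
    linarith
  rw [hE, profB]
  generalize profA (r ^ 2 / 4) = A at *
  generalize u r = a at *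
  generalize m r = b at *
  have hA0 : 0 < A := by linarith
  have hsq : 0 ≤ (r ^ 2 / 4 * A) * (2 / r * u' - (1 / (2 * (r ^ 2 / 4)) - 1) * a
      + 1 / 100 * (1 + 4 * (r ^ 2 / 4)) / (1 + r ^ 2 / 4) ^ 2 * b * (1 + r ^ 2 / 4 * A) /
        (r / 2 * (r ^ 2 / 4 * A))) ^ 2 := by positivity
  -- The gain 2βeˢ absorbs 𝒜/1000.
  have hu2 : 0 ≤ (2 * (1 / 100 * (1 + 4 * (r ^ 2 / 4)) / (1 + r ^ 2 / 4) ^ 2)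
      * (1 + r ^ 2 / 4 * A) - 1 / 1000 * A) * a ^ 2 := by
    refine mul_nonneg ?_ (sq_nonneg _)
    have : 0 ≤ (20 * (1 + 4 * (r ^ 2 / 4)) * (1 + r ^ 2 / 4 * A) - A * (1 + r ^ 2 / 4) ^ 2) /
        (1000 * (1 + r ^ 2 / 4) ^ 2) := by
      refine div_nonneg ?_ (by positivity)
      have h5 : A * (1 - r ^ 2 / 4) ≤ 1 := hA5
      generalize r ^ 2 / 4 = s at *
      nlinarith [mul_nonneg hs0.le hA0.le, mul_nonneg (mul_nonneg hs0.le hs0.le) hA0.le]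
    refine this.trans_eq ?_
    field_simp
    ring
  have hm1 : 0 ≤ (1 + r ^ 2 / 4 * A) / (r ^ 2 / 4) *
      (1 / 100 / ((r ^ 2 / 4) * (1 + r ^ 2 / 4) ^ 4) * (199 / 100 + 591 / 100 * (r ^ 2 / 4)
        - 1024 / 100 * (r ^ 2 / 4) ^ 2 + 384 / 100 * (r ^ 2 / 4) ^ 3)) * b ^ 2 := by
    have : 0 ≤ 199 / 100 + 591 / 100 * (r ^ 2 / 4)
        - 1024 / 100 * (r ^ 2 / 4) ^ 2 + 384 / 100 * (r ^ 2 / 4) ^ 3 := by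
      generalize r ^ 2 / 4 = s at *
      nlinarith [mul_nonneg hs0.le (sq_nonneg (s - 4 / 3)), sq_nonneg (s - 4 / 3)]
    positivity
  -- The square costs a multiple of β²eˢ/(sA) = β²(1 + 1/(sA)). The previous term used 1/(sA) ≤ 1/s;
  -- this is the slack.
  have hm2 : 0 ≤ (1 + r ^ 2 / 4 * A) / (r ^ 2 / 4) *
      ((1 / 100 * (1 + 4 * (r ^ 2 / 4)) / (1 + r ^ 2 / 4) ^ 2) ^ 2 *
        ((A - 1) / (r ^ 2 / 4 * A))) * b ^ 2 := by
    have : 0 ≤ A - 1 := by linarith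
    positivity
  have hsum := mul_nonneg hr.le (add_nonneg (add_nonneg hsq hu2) (add_nonneg hm1 hm2))
  rw [← sub_nonneg]
  refine hsum.trans_eq ?_
  have hr0 := hr.ne'
  simp only [Nat.add_one_sub_one, pow_one, Nat.cast_ofNat]
  field_simp
  ring

/-- Potential function for the angular modes of order at least two; `S` stands for the angular
integral of the square. -/
def potTwo (s S : ℝ) : ℝ := 2 * (profA s * (1 / 2 - 7 / 8 * s) * S)

/-- The hypothesis `hN` encodes ∫(f_r - pf)² ≥ 0 and is used with p the logarithmic derivative of √s
e^(-7s/8). Compared with mode one, the angular term supplies an extra 3𝒜/(4s). The exponent 1 would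
leave 𝒜(3/(4s) - 1/1000), negative for large s; 7/8 adds (7/8)(1/8)s𝒜 = 7s𝒜/64, enough to pay for
the other losses. -/
theorem exists_hasDerivAt_potTwo_le {S : ℝ → ℝ} {C N r : ℝ} (hr : 0 < r)
    (hS : HasDerivAt S (2 * C) r) (hS0 : 0 ≤ S r)
    (hN : ∀ p, 0 ≤ N - 2 * p * C + p ^ 2 * S r) :
    ∃ d, HasDerivAt (fun r => potTwo (r ^ 2 / 4) (S r)) d r ∧
      d ≤ r * (profA (r ^ 2 / 4) * N + 4 * profA (r ^ 2 / 4) / r ^ 2 * S r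
        - (profB (r ^ 2 / 4) + 1 / 1000 * profA (r ^ 2 / 4)) * S r) := by
  have hs := hasDerivAt_sq_div_four r
  have hs0 : 0 < r ^ 2 / 4 := by positivity
  have hA : HasDerivAt (fun r : ℝ => profA (r ^ 2 / 4))
      ((Real.exp (r ^ 2 / 4) - profA (r ^ 2 / 4)) / (r ^ 2 / 4) * (r / 2)) r :=
    (hasDerivAt_profA hs0.ne').comp r hs
  have hd := ((hA.fun_mul ((hs.const_mul (7 / 8)).const_sub (1 / 2))).fun_mul hS).const_mul 2
  refine ⟨_, hd, ?_⟩
  have hA1 := one_le_profA hs0.le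
  have hp := mul_nonneg (zero_le_one.trans hA1) (hN (r / 2 * (1 / (2 * (r ^ 2 / 4)) - 7 / 8)))
  have hE : Real.exp (r ^ 2 / 4) = 1 + r ^ 2 / 4 * profA (r ^ 2 / 4) := by
    linarith [mul_profA (r ^ 2 / 4)]
  rw [hE, profB]
  generalize profA (r ^ 2 / 4) = A at *
  generalize S r = b at *
  have hrest : 0 ≤ ((A - 1) * (1 / 8)
     + A * (3 / (4 * (r ^ 2 / 4)) + 7 / 64 * (r ^ 2 / 4) - 1 / 4 - 1 / 1000)) * b := by
    generalize r ^ 2 / 4 = s at *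
    have h1 : 0 ≤ (750 - 251 * s + 875 / 8 * s ^ 2) / (1000 * s) :=
      div_nonneg (by nlinarith [sq_nonneg (s - 1)]) (by positivity)
    have h2 : 3 / (4 * s) + 7 / 64 * s - 1 / 4 - 1 / 1000 =
        (750 - 251 * s + 875 / 8 * s ^ 2) / (1000 * s) := by
      field_simp
      ring
    rw [h2]
    have h3 : 0 ≤ A - 1 := by linarith
    have h4 : 0 ≤ A := by linarith
    exact mul_nonneg (add_nonneg (by positivity) (mul_nonneg h4 h1)) hS0
  have hsum := mul_nonneg hr.le (add_nonneg hp hrest)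
  rw [← sub_nonneg]
  refine hsum.trans_eq ?_
  have hr0 := hr.ne'
  field_simp
  ring

end

/-! ### Fourier inequalities on the circle -/

section

open MeasureTheory

/-- Bessel's inequality on the circle for the modes `1`, `cos θ` and `sin θ`. -/
theorem bessel_circle {h : ℝ → ℝ} (hc : Continuous h) :
    (∫ θ in (-Real.pi)..Real.pi, h θ) ^ 2 / (2 * Real.pi)
      + ((∫ θ in (-Real.pi)..Real.pi, h θ * Real.cos θ) ^ 2
        + (∫ θ in (-Real.pi)..Real.pi, h θ * Real.sin θ) ^ 2) / Real.pi
      ≤ ∫ θ in (-Real.pi)..Real.pi, h θ ^ 2 := by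
  have hpi := Real.pi_pos
  set c₀ := ∫ θ in (-Real.pi)..Real.pi, h θ with h0
  set c₁ := ∫ θ in (-Real.pi)..Real.pi, h θ * Real.cos θ with h1
  set c₂ := ∫ θ in (-Real.pi)..Real.pi, h θ * Real.sin θ with h2
  set a := c₀ / (2 * Real.pi) with ha
  set b := c₁ / Real.pi with hb
  set c := c₂ / Real.pi with hcd
  -- Squared distance from h to its projection on the three modes.
  have key : 0 ≤ ∫ θ in (-Real.pi)..Real.pi, (h θ - a - b * Real.cos θ - c * Real.sin θ) ^ 2 :=
    intervalIntegral.integral_nonneg (by linarith) fun _ _ => sq_nonneg _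
  have i0 : ∫ θ in (-Real.pi)..Real.pi, Real.cos θ = 0 := by simp
  have i1 : ∫ θ in (-Real.pi)..Real.pi, Real.sin θ = 0 := by simp
  have i2 : ∫ θ in (-Real.pi)..Real.pi, Real.cos θ ^ 2 = Real.pi := by
    rw [integral_cos_sq]; simp
  have i3 : ∫ θ in (-Real.pi)..Real.pi, Real.sin θ ^ 2 = Real.pi := by
    rw [integral_sin_sq]; simp
  have i4 : ∫ θ in (-Real.pi)..Real.pi, Real.sin θ * Real.cos θ = 0 := by
    rw [integral_sin_mul_cos₁]; simp
  have hsum : ∫ θ in (-Real.pi)..Real.pi, (h θ - a - b * Real.cos θ - c * Real.sin θ) ^ 2 =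
      (∫ θ in (-Real.pi)..Real.pi, h θ ^ 2) + (-2 * a) * c₀ + (-2 * b) * c₁ + (-2 * c) * c₂
      + a ^ 2 * (2 * Real.pi) + b ^ 2 * Real.pi + c ^ 2 * Real.pi := by
    have e : ∀ θ, (h θ - a - b * Real.cos θ - c * Real.sin θ) ^ 2 =
        h θ ^ 2 + (-2 * a) * h θ + (-2 * b) * (h θ * Real.cos θ) + (-2 * c) * (h θ * Real.sin θ)
        + a ^ 2 + b ^ 2 * Real.cos θ ^ 2 + c ^ 2 * Real.sin θ ^ 2 + (2 * a * b) * Real.cos θ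
        + (2 * a * c) * Real.sin θ + (2 * b * c) * (Real.sin θ * Real.cos θ) := fun θ => by ring
    simp_rw [e]
    have hi : ∀ {f : ℝ → ℝ}, Continuous f → IntervalIntegrable f volume (-Real.pi) Real.pi :=
      fun hf => hf.intervalIntegrable _ _
    repeat rw [intervalIntegral.integral_add (hi (by fun_prop)) (hi (by fun_prop))]
    simp only [intervalIntegral.integral_const_mul, i0, i1, i2, i3, i4, ← h0, ← h1, ← h2,
      intervalIntegral.integral_const, smul_eq_mul]
    ring
  rw [hsum] at key
  have : c₀ ^ 2 / (2 * Real.pi) + (c₁ ^ 2 + c₂ ^ 2) / Real.pi =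
      -((-2 * a) * c₀ + (-2 * b) * c₁ + (-2 * c) * c₂
      + a ^ 2 * (2 * Real.pi) + b ^ 2 * Real.pi + c ^ 2 * Real.pi) := by
    rw [ha, hb, hcd]
    field_simp
    ring
  linarith

/-- Wirtinger's inequality on the circle, with the modes of order at most one removed. -/
theorem wirtinger_circle {h h' : ℝ → ℝ} (hd : ∀ θ, HasDerivAt h (h' θ) θ) (hc' : Continuous h')
    (hper : h (-Real.pi) = h Real.pi) :
    4 * (∫ θ in (-Real.pi)..Real.pi, h θ ^ 2)
      - 2 / Real.pi * (∫ θ in (-Real.pi)..Real.pi, h θ) ^ 2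
      - 3 / Real.pi * ((∫ θ in (-Real.pi)..Real.pi, h θ * Real.cos θ) ^ 2
        + (∫ θ in (-Real.pi)..Real.pi, h θ * Real.sin θ) ^ 2)
      ≤ ∫ θ in (-Real.pi)..Real.pi, h' θ ^ 2 := by
  have hpi := Real.pi_pos
  have hab : -Real.pi < Real.pi := by linarith
  have hc : Continuous h := continuous_iff_continuousAt.2 fun θ => (hd θ).continuousAt
  have mem : ∀ {f : ℝ → ℝ}, Continuous f →
      MemLp (fun θ => (f θ : ℂ)) 2 (volume.restrict (Set.Ioc (-Real.pi) Real.pi)) := by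
    intro f hf
    have hfc : Continuous (fun θ => (f θ : ℂ)) := by fun_prop
    obtain ⟨C, hC⟩ := (isCompact_Icc (a := -Real.pi) (b := Real.pi)).exists_bound_of_continuousOn
      hfc.continuousOn
    refine MemLp.of_bound hfc.aestronglyMeasurable C ?_
    filter_upwards [ae_restrict_mem measurableSet_Ioc] with θ hθ
    exact hC θ (Set.Ioc_subset_Icc_self hθ)
  set c := fourierCoeffOn hab (fun θ => (h θ : ℂ)) with hcdef
  set c' := fourierCoeffOn hab (fun θ => (h' θ : ℂ)) with hcdef'
  have s := hasSum_sq_fourierCoeffOn hab (mem hc)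
  have s' := hasSum_sq_fourierCoeffOn hab (mem hc')
  have hcoef : ∀ n : ℤ, n ≠ 0 → ‖c' n‖ ^ 2 = (n : ℝ) ^ 2 * ‖c n‖ ^ 2 := by
    intro n hn
    have := fourierCoeffOn_of_hasDerivAt hab hn (f := fun θ => (h θ : ℂ))
      (f' := fun θ => (h' θ : ℂ)) (fun x _ => (hd x).ofReal_comp)
      ((by fun_prop : Continuous fun θ => (h' θ : ℂ)).intervalIntegrable _ _)
    -- Periodicity removes the boundary term.
    rw [← hcdef, ← hcdef', hper] at this
    have hn' : (n : ℂ) ≠ 0 := by exact_mod_cast hn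
    have hp : (Real.pi : ℂ) ≠ 0 := by exact_mod_cast hpi.ne'
    have h2 : c' n = Complex.I * n * c n := by
      rw [this]
      push_cast
      have := Complex.I_ne_zero
      field_simp
      ring
    rw [h2]
    simp [mul_pow]
  have f0 : ‖c 0‖ ^ 2 = (∫ θ in (-Real.pi)..Real.pi, h θ) ^ 2 / (2 * Real.pi) ^ 2 := by
    rw [hcdef, fourierCoeffOn_eq_integral]
    simp only [neg_zero, fourier_zero, one_smul, intervalIntegral.integral_ofReal, norm_smul,
      Complex.norm_real, mul_pow, Real.norm_eq_abs, sq_abs]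
    field_simp
    ring
  have f1 : ∀ n : ℤ, n = 1 ∨ n = -1 → ‖c n‖ ^ 2 =
      ((∫ θ in (-Real.pi)..Real.pi, h θ * Real.cos θ) ^ 2
        + (∫ θ in (-Real.pi)..Real.pi, h θ * Real.sin θ) ^ 2) / (2 * Real.pi) ^ 2 := by
    intro n hn
    have e : ∀ θ : ℝ, fourier (-n) (θ : AddCircle (Real.pi - -Real.pi)) • (h θ : ℂ) =
        ((h θ * Real.cos θ : ℝ) : ℂ) + (-n * Complex.I) * ((h θ * Real.sin θ : ℝ) : ℂ) := by
      intro θ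
      have : fourier (-n) (θ : AddCircle (Real.pi - -Real.pi)) =
          Complex.exp ((-n * θ : ℝ) * Complex.I) := by
        rw [fourier_coe_apply]
        congr 1
        have hp : (Real.pi : ℂ) ≠ 0 := by exact_mod_cast hpi.ne'
        push_cast
        field_simp
        ring
      rw [this, Complex.exp_mul_I, ← Complex.ofReal_cos, ← Complex.ofReal_sin]
      rcases hn with rfl | rfl
      · simp; ring
      · simp; ring
    have hi : ∀ {f : ℝ → ℂ}, Continuous f → IntervalIntegrable f volume (-Real.pi) Real.pi :=
      fun hf => hf.intervalIntegrable _ _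
    rw [hcdef, fourierCoeffOn_eq_integral]
    simp_rw [e]
    rw [intervalIntegral.integral_add (hi (by fun_prop)) (hi (by fun_prop)),
      intervalIntegral.integral_const_mul, intervalIntegral.integral_ofReal,
      intervalIntegral.integral_ofReal, norm_smul, mul_pow, ← Complex.normSq_eq_norm_sq,
      Complex.normSq_apply]
    rcases hn with rfl | rfl
    · simp
      field_simp
      ring
    · simp
      field_simp
      ring
  -- Subtracting 4 at n = 0 and 3 = 4 - 1 at n = ±1 leaves only n² ≥ 4 for |n| ≥ 2 to be used.
  have t := (((s.mul_left 4).sub (hasSum_ite_eq (0 : ℤ) (4 * ‖c 0‖ ^ 2))).sub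
    (hasSum_ite_eq (1 : ℤ) (3 * ‖c 1‖ ^ 2))).sub (hasSum_ite_eq (-1 : ℤ) (3 * ‖c (-1)‖ ^ 2))
  have hle := hasSum_le (fun n => ?_) t s'
  · rw [f0, f1 1 (by simp), f1 (-1) (by simp)] at hle
    simp only [Complex.norm_real, Real.norm_eq_abs, sq_abs, smul_eq_mul, sub_neg_eq_add] at hle
    have h2 := mul_le_mul_of_nonneg_left hle (by positivity : 0 ≤ 2 * Real.pi)
    refine le_trans (le_of_eq ?_) (h2.trans (le_of_eq ?_))
    · field_simp
      ring
    · field_simp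
      ring
  · change 4 * ‖c n‖ ^ 2 - _ - _ - _ ≤ ‖c' n‖ ^ 2
    rcases eq_or_ne n 0 with rfl | h0
    · simp
    rw [hcoef n h0]
    rcases eq_or_ne n 1 with rfl | h1
    · simp; nlinarith [sq_nonneg ‖c 1‖]
    rcases eq_or_ne n (-1) with rfl | h2
    · simp; nlinarith [sq_nonneg ‖c (-1)‖]
    simp only [h0, h1, h2, if_false, sub_zero]
    have : (4 : ℝ) ≤ (n : ℝ) ^ 2 := by
      have : (4 : ℤ) ≤ n ^ 2 := by
        rcases (by omega : 2 ≤ n ∨ n ≤ -2) with h | h <;> nlinarith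
      exact_mod_cast this
    exact mul_le_mul_of_nonneg_right this (sq_nonneg _)

end

/-! ### Polar coordinates in the plane -/

section

open MeasureTheory

/-- Standard basis vector of the plane. -/
def stdVec (j : Fin 2) : Plane := EuclideanSpace.single j 1

/-- The radial unit vector at angle `θ`. -/
def radialVec (θ : ℝ) : Plane := Real.cos θ • stdVec 0 + Real.sin θ • stdVec 1

/-- The angular unit vector at angle `θ`. -/
def angularVec (θ : ℝ) : Plane := -Real.sin θ • stdVec 0 + Real.cos θ • stdVec 1

@[fun_prop]
theorem continuous_radialVec : Continuous radialVec := by unfold radialVec; fun_prop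

@[fun_prop]
theorem continuous_angularVec : Continuous angularVec := by unfold angularVec; fun_prop

theorem hasDerivAt_radialVec (θ : ℝ) : HasDerivAt radialVec (angularVec θ) θ :=
  ((Real.hasDerivAt_cos θ).smul_const _).add ((Real.hasDerivAt_sin θ).smul_const _)

theorem radialVec_apply_zero (θ : ℝ) : radialVec θ 0 = Real.cos θ := by
  simp [radialVec, stdVec]

theorem radialVec_apply_one (θ : ℝ) : radialVec θ 1 = Real.sin θ := by
  simp [radialVec, stdVec]

theorem norm_radialVec (θ : ℝ) : ‖radialVec θ‖ = 1 := by
  rw [EuclideanSpace.norm_eq, Fin.sum_univ_two, radialVec_apply_zero, radialVec_apply_one]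
  simp

theorem radialVec_neg_pi : radialVec (-Real.pi) = radialVec Real.pi := by
  simp [radialVec]

theorem norm_smul_radialVec (r θ : ℝ) : ‖r • radialVec θ‖ ^ 2 = r ^ 2 := by
  rw [norm_smul, norm_radialVec, mul_one, Real.norm_eq_abs, sq_abs]

theorem fderiv_eq_inner_gradient (φ : Plane → ℝ) (x v : Plane) :
    fderiv ℝ φ x v = inner ℝ (gradient φ x) v := by
  rw [gradient, InnerProductSpace.toDual_symm_apply]

theorem gradient_apply (φ : Plane → ℝ) (x : Plane) (j : Fin 2) :
    gradient φ x j = fderiv ℝ φ x (EuclideanSpace.single j 1) := by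
  rw [fderiv_eq_inner_gradient, EuclideanSpace.inner_single_right]
  simp

/-- The two vectors form an orthonormal basis for every θ, which need not be the polar angle of x.
-/
theorem norm_gradient_sq (φ : Plane → ℝ) (x : Plane) (θ : ℝ) :
    ‖gradient φ x‖ ^ 2 =
      fderiv ℝ φ x (radialVec θ) ^ 2 + fderiv ℝ φ x (angularVec θ) ^ 2 := by
  have h0 : fderiv ℝ φ x (stdVec 0) = gradient φ x 0 := (gradient_apply φ x 0).symm
  have h1 : fderiv ℝ φ x (stdVec 1) = gradient φ x 1 := (gradient_apply φ x 1).symm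
  rw [EuclideanSpace.norm_sq_eq, Fin.sum_univ_two, radialVec, angularVec]
  simp only [map_add, map_smul, h0, h1, smul_eq_mul, Real.norm_eq_abs, sq_abs]
  linear_combination -(gradient φ x 0 ^ 2 + gradient φ x 1 ^ 2) * Real.sin_sq_add_cos_sq θ

/-- Differentiation under the angular integral. -/
theorem hasDerivAt_angular_integral {G G' : ℝ → ℝ → ℝ}
    (hd : ∀ r θ, HasDerivAt (fun r => G r θ) (G' r θ) r)
    (hc : Continuous (Function.uncurry G)) (hc' : Continuous (Function.uncurry G')) (r : ℝ) :
    HasDerivAt (fun r => ∫ θ in (-Real.pi)..Real.pi, G r θ)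
      (∫ θ in (-Real.pi)..Real.pi, G' r θ) r := by
  obtain ⟨C, hC⟩ := ((isCompact_closedBall r 1).prod
    (isCompact_uIcc (a := -Real.pi) (b := Real.pi))).exists_bound_of_continuousOn hc'.continuousOn
  have hG : ∀ r, Continuous (G r) := fun r => hc.comp (by fun_prop : Continuous fun θ => (r, θ))
  have hG' : ∀ r, Continuous (G' r) := fun r => hc'.comp (by fun_prop : Continuous fun θ => (r, θ))
  refine (intervalIntegral.hasDerivAt_integral_of_dominated_loc_of_deriv_le
    (bound := fun _ => C) (Metric.closedBall_mem_nhds r one_pos)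
    (.of_forall fun r => (hG r).aestronglyMeasurable) ((hG r).intervalIntegrable _ _)
    (hG' r).aestronglyMeasurable (.of_forall fun θ hθ ρ hρ => ?_) (by simp)
    (.of_forall fun θ _ ρ _ => hd ρ θ)).2
  exact hC (ρ, θ) ⟨hρ, Set.uIoc_subset_uIcc hθ⟩

theorem integral_plane_eq_prod (g : Plane → ℝ) :
    ∫ x, g x = ∫ p : ℝ × ℝ, g (p.1 • stdVec 0 + p.2 • stdVec 1) := by
  have h1 := (volume_preserving_finTwoArrow ℝ).symm.integral_comp'
    (g := fun y : Fin 2 → ℝ => g (WithLp.toLp 2 y))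
  have h2 :=
    (EuclideanSpace.volume_preserving_symm_measurableEquiv_toLp (Fin 2)).symm.integral_comp'
    (g := g)
  refine h2.symm.trans (h1.symm.trans ?_)
  refine integral_congr_ae (.of_forall fun p => ?_)
  change g _ = g _
  congr 1
  ext j
  fin_cases j
  · simp [stdVec]
  · simp [stdVec]

/-- Integration in polar coordinates of a function supported in a disc. -/
theorem integral_plane_eq_polar {g : Plane → ℝ} {R : ℝ} (hR : 0 ≤ R)
    (hg : ∀ x, R < ‖x‖ → g x = 0)
    (hint : IntegrableOn (fun p : ℝ × ℝ => p.1 * g (p.1 • radialVec p.2))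
      (Set.Ioc 0 R ×ˢ Set.Ioc (-Real.pi) Real.pi)) :
    IntegrableOn (fun r => ∫ θ in (-Real.pi)..Real.pi, r * g (r • radialVec θ)) (Set.Icc 0 R) ∧
    ∫ x, g x = ∫ r in (0 : ℝ)..R, ∫ θ in (-Real.pi)..Real.pi, r * g (r • radialVec θ) := by
  have hpi : -Real.pi ≤ Real.pi := by linarith [Real.pi_pos]
  simp only [intervalIntegral.integral_of_le hpi, intervalIntegral.integral_of_le hR]
  constructor
  · rw [integrableOn_Icc_iff_integrableOn_Ioc]
    rw [IntegrableOn, Measure.volume_eq_prod, ← Measure.prod_restrict] at hint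
    exact hint.integral_prod_left
  · rw [integral_plane_eq_prod, ← integral_comp_polarCoord_symm]
    rw [Measure.volume_eq_prod] at hint ⊢
    rw [← setIntegral_prod _ hint]
    -- The radii r > R contribute nothing, and the endpoint θ = π is a null set.
    have h1 : (Set.Ioc 0 R ×ˢ Set.Ioo (-Real.pi) Real.pi : Set (ℝ × ℝ)) ⊆ polarCoord.target :=
      Set.prod_mono Set.Ioc_subset_Ioi_self subset_rfl
    rw [setIntegral_eq_of_subset_of_forall_sdiff_eq_zero polarCoord.open_target.measurableSet h1]
    · have h2 : (Set.Ioc 0 R ×ˢ Set.Ioo (-Real.pi) Real.pi : Set (ℝ × ℝ)) =ᵐ[volume.prod volume]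
          (Set.Ioc 0 R ×ˢ Set.Ioc (-Real.pi) Real.pi : Set (ℝ × ℝ)) :=
        Measure.set_prod_ae_eq (ae_eq_refl _) Ioo_ae_eq_Ioc
      rw [setIntegral_congr_set h2]
      refine integral_congr_ae (.of_forall fun p => ?_)
      simp [polarCoord_symm_apply, radialVec, smul_add, smul_smul]
    · rintro ⟨r, θ⟩ ⟨⟨hr, hθ⟩, hn⟩
      have hr' : R < r := by
        by_contra hle
        exact hn ⟨⟨hr, not_lt.1 hle⟩, hθ⟩
      have : g (r • radialVec θ) = 0 := hg _ (by
        rw [norm_smul, norm_radialVec, mul_one, Real.norm_eq_abs, abs_of_pos hr]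
        exact hr')
      simp only [polarCoord_symm_apply, smul_eq_mul, mul_eq_zero]
      right
      rw [← this]
      simp [radialVec, smul_add, smul_smul]

end

/-! ### Coercivity for compactly supported C¹ functions -/

section

open MeasureTheory Filter Topology

theorem continuous_potZero : Continuous fun p : ℝ × ℝ × ℝ => potZero p.1 p.2.1 p.2.2 := by
  unfold potZero
  fun_prop

theorem continuous_potOne_comp {u q : ℝ → ℝ} (hu : Continuous u) (hq : Continuous q) :
    Continuous fun r => potOne (r ^ 2 / 4) (u r) (q r) := by
  have hA : Continuous fun r : ℝ => profA (r ^ 2 / 4) := continuous_profA.comp (by fun_prop)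
  have h2 : ∀ r : ℝ, (1 + r ^ 2 / 4) ^ 2 ≠ 0 := fun r => by positivity
  have h3 : ∀ r : ℝ, (1 + r ^ 2 / 4) ^ 3 ≠ 0 := fun r => by positivity
  unfold potOne
  fun_prop (disch := assumption)

theorem continuous_potTwo_comp {S : ℝ → ℝ} (hS : Continuous S) :
    Continuous fun r => potTwo (r ^ 2 / 4) (S r) := by
  have hA : Continuous fun r : ℝ => profA (r ^ 2 / 4) := continuous_profA.comp (by fun_prop)
  unfold potTwo
  fun_prop

/-- The quotient `m r / r` is continuous if `m` is differentiable and vanishes to second order. -/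
theorem continuous_div_self_of_hasDerivAt {m m' : ℝ → ℝ} (hm : ∀ r, HasDerivAt m (m' r) r)
    (h0 : m 0 = 0) (h0' : m' 0 = 0) : Continuous fun r => m r / r := by
  rw [continuous_iff_continuousAt]
  intro r
  rcases eq_or_ne r 0 with rfl | hr
  · rw [← continuousWithinAt_compl_self, ContinuousWithinAt]
    have := (hm 0).tendsto_slope_zero
    simp only [zero_add, h0, h0', sub_zero, smul_eq_mul] at this
    simpa [div_eq_inv_mul] using this
  · exact (hm r).continuousAt.div continuousAt_id hr

section Smooth

variable {φ : Plane → ℝ}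

theorem hasDerivAt_radial (hφ : ContDiff ℝ 1 φ) (r θ : ℝ) :
    HasDerivAt (fun r => φ (r • radialVec θ)) (fderiv ℝ φ (r • radialVec θ) (radialVec θ)) r := by
  have h1 : HasDerivAt (fun r : ℝ => r • radialVec θ) (radialVec θ) r := by
    simpa using (hasDerivAt_id r).smul_const (radialVec θ)
  exact ((hφ.differentiable one_ne_zero) _).hasFDerivAt.comp_hasDerivAt r h1

theorem hasDerivAt_angle (hφ : ContDiff ℝ 1 φ) (r θ : ℝ) :
    HasDerivAt (fun θ => φ (r • radialVec θ))
      (r * fderiv ℝ φ (r • radialVec θ) (angularVec θ)) θ := by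
  have h1 : HasDerivAt (fun θ : ℝ => r • radialVec θ) (r • angularVec θ) θ :=
    (hasDerivAt_radialVec θ).const_smul r
  exact (((hφ.differentiable one_ne_zero) (r • radialVec θ)).hasFDerivAt.comp_hasDerivAt θ
    h1).congr_deriv (by simp)

theorem continuous_polar (hφ : ContDiff ℝ 1 φ) :
    Continuous fun p : ℝ × ℝ => φ (p.1 • radialVec p.2) := by
  have := hφ.continuous
  fun_prop

theorem continuous_polar_radial (hφ : ContDiff ℝ 1 φ) :
    Continuous fun p : ℝ × ℝ => fderiv ℝ φ (p.1 • radialVec p.2) (radialVec p.2) := by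
  have := hφ.continuous_fderiv one_ne_zero
  fun_prop

theorem continuous_polar_angular (hφ : ContDiff ℝ 1 φ) :
    Continuous fun p : ℝ × ℝ => fderiv ℝ φ (p.1 • radialVec p.2) (angularVec p.2) := by
  have := hφ.continuous_fderiv one_ne_zero
  fun_prop

/-- The integrand of the coercivity estimate, with the explicit profile of `ℬ`. -/
def coerciveDensity (φ : Plane → ℝ) (x : Plane) : ℝ :=
  profA (‖x‖ ^ 2 / 4) * ‖gradient φ x‖ ^ 2
    - (profB (‖x‖ ^ 2 / 4) + 1 / 1000 * profA (‖x‖ ^ 2 / 4)) * φ x ^ 2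

/-- The coercivity integrand in polar coordinates is integrable on bounded rectangles. -/
theorem integrableOn_coerciveDensity (hφ : ContDiff ℝ 1 φ) (R : ℝ) :
    IntegrableOn (fun p : ℝ × ℝ => p.1 * coerciveDensity φ (p.1 • radialVec p.2))
      (Set.Ioc 0 R ×ˢ Set.Ioc (-Real.pi) Real.pi) := by
  have hA : Continuous fun p : ℝ × ℝ => profA (p.1 ^ 2 / 4) := continuous_profA.comp (by fun_prop)
  have hF := continuous_polar hφ
  have hφc := hφ.continuous
  have hφc' := hφ.continuous_fderiv one_ne_zero
  have hcpt : IsCompact (Set.Icc 0 R ×ˢ Set.Icc (-Real.pi) Real.pi) :=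
    isCompact_Icc.prod isCompact_Icc
  have hsub : (Set.Ioc 0 R ×ˢ Set.Ioc (-Real.pi) Real.pi : Set (ℝ × ℝ)) ⊆
      Set.Icc 0 R ×ˢ Set.Icc (-Real.pi) Real.pi :=
    Set.prod_mono Set.Ioc_subset_Icc_self Set.Ioc_subset_Icc_self
  have hi : ∀ {f : ℝ × ℝ → ℝ}, Continuous f →
      IntegrableOn f (Set.Ioc 0 R ×ˢ Set.Ioc (-Real.pi) Real.pi) := fun hf =>
    (hf.continuousOn.integrableOn_compact hcpt).mono_set hsub
  have e : ∀ p : ℝ × ℝ, p.1 * coerciveDensity φ (p.1 • radialVec p.2) =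
      p.1 * (profA (p.1 ^ 2 / 4) * (fderiv ℝ φ (p.1 • radialVec p.2) (radialVec p.2) ^ 2
        + fderiv ℝ φ (p.1 • radialVec p.2) (angularVec p.2) ^ 2)
        - 1 / 1000 * profA (p.1 ^ 2 / 4) * φ (p.1 • radialVec p.2) ^ 2)
      - p.1 * profB (p.1 ^ 2 / 4) * φ (p.1 • radialVec p.2) ^ 2 := fun p => by
    rw [coerciveDensity, norm_smul_radialVec, norm_gradient_sq φ _ p.2]
    ring
  simp_rw [e]
  refine Integrable.sub (hi (by fun_prop)) ?_
  -- With division by zero equal to zero, `profB` is discontinuous at s = 0, so this term is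
  -- dominated through ℬ ≤ 2𝒜.
  refine Integrable.mono' (g := fun p : ℝ × ℝ => p.1 * (2 * profA (p.1 ^ 2 / 4)) *
    φ (p.1 • radialVec p.2) ^ 2) (hi (by fun_prop)) ?_ ?_
  · have hB := measurable_profB
    have hm := hF.measurable
    exact (((measurable_fst.mul (hB.comp (by fun_prop : Measurable fun p : ℝ × ℝ =>
      p.1 ^ 2 / 4))).mul (hm.pow_const 2))).aestronglyMeasurable
  · filter_upwards [ae_restrict_mem (measurableSet_Ioc.prod measurableSet_Ioc)] with p hp
    have hp0 : 0 < p.1 := hp.1.1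
    have hs : 0 < p.1 ^ 2 / 4 := by positivity
    have hB0 := profB_nonneg hs.le
    have hB := profB_le hs
    rw [Real.norm_of_nonneg (by positivity)]
    gcongr

theorem exists_support_radius (hc : HasCompactSupport φ) :
    ∃ R : ℝ, 0 < R ∧ ∀ x, R ≤ ‖x‖ → φ x = 0 := by
  obtain ⟨R, hR, h⟩ := hc.isBounded.exists_pos_norm_lt
  exact ⟨R, hR, fun x hx => by
    by_contra hne
    exact (h x (subset_tsupport φ hne)).not_ge hx⟩

/-- Moments of a compactly supported function in polar coordinates. -/
theorem integral_mul_eq_polar (hφ : ContDiff ℝ 1 φ) {R : ℝ} (hR : 0 < R)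
    (hsupp : ∀ x, R ≤ ‖x‖ → φ x = 0) {w : Plane → ℝ} (hw : Continuous w) :
    ∫ x, w x * φ x = ∫ r in (0 : ℝ)..R, ∫ θ in (-Real.pi)..Real.pi,
      r * (w (r • radialVec θ) * φ (r • radialVec θ)) := by
  refine (integral_plane_eq_polar (g := fun x => w x * φ x) hR.le
    (fun x hx => by rw [hsupp x hx.le, mul_zero]) ?_).2
  have hF := continuous_polar hφ
  have hw' : Continuous fun p : ℝ × ℝ => w (p.1 • radialVec p.2) := by
      fun_prop
  have hcpt : IsCompact (Set.Icc 0 R ×ˢ Set.Icc (-Real.pi) Real.pi) :=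
    isCompact_Icc.prod isCompact_Icc
  have hcont : Continuous fun p : ℝ × ℝ =>
    p.1 * (w (p.1 • radialVec p.2) * φ (p.1 • radialVec p.2)) := by fun_prop
  exact (hcont.continuousOn.integrableOn_compact hcpt).mono_set
    (Set.prod_mono Set.Ioc_subset_Icc_self Set.Ioc_subset_Icc_self)

/-- Coercivity for smooth compactly supported functions with vanishing moments. -/
theorem integral_coerciveDensity_nonneg (hφ : ContDiff ℝ 1 φ) (hc : HasCompactSupport φ)
    (h0 : ∫ x, φ x = 0) (h1 : ∀ j : Fin 2, ∫ x, x j * φ x = 0) :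
    0 ≤ ∫ x, coerciveDensity φ x := by
  obtain ⟨R, hR, hsupp⟩ := exists_support_radius hc
  have hpi := Real.pi_pos
  have hF := continuous_polar hφ
  have hFr := continuous_polar_radial hφ
  have hFt := continuous_polar_angular hφ
  set F : ℝ → ℝ → ℝ := fun r θ => φ (r • radialVec θ) with hFdef
  set Fr : ℝ → ℝ → ℝ := fun r θ => fderiv ℝ φ (r • radialVec θ) (radialVec θ) with hFrdef
  set Ft : ℝ → ℝ → ℝ := fun r θ => fderiv ℝ φ (r • radialVec θ) (angularVec θ) with hFtdef
  have hFc : Continuous (Function.uncurry F) := hF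
  have hFrc : Continuous (Function.uncurry Fr) := hFr
  have hFtc : Continuous (Function.uncurry Ft) := hFt
  have hFθ : ∀ r, Continuous (F r) := fun r => hFc.comp (by fun_prop : Continuous fun θ => (r, θ))
  have hFrθ : ∀ r, Continuous (Fr r) := fun r =>
    hFrc.comp (by fun_prop : Continuous fun θ => (r, θ))
  have hFtθ : ∀ r, Continuous (Ft r) := fun r =>
    hFtc.comp (by fun_prop : Continuous fun θ => (r, θ))
  have hFz : ∀ r θ, R ≤ r → F r θ = 0 := fun r θ hr => hsupp _ (by
    rw [norm_smul, norm_radialVec, mul_one, Real.norm_eq_abs]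
    exact hr.trans (le_abs_self r))
  -- angular moments
  set c₀ : ℝ → ℝ := fun r => ∫ θ in (-Real.pi)..Real.pi, F r θ with hc₀
  set c₁ : ℝ → ℝ := fun r => ∫ θ in (-Real.pi)..Real.pi, F r θ * Real.cos θ with hc₁
  set c₂ : ℝ → ℝ := fun r => ∫ θ in (-Real.pi)..Real.pi, F r θ * Real.sin θ with hc₂
  set S₀ : ℝ → ℝ := fun r => ∫ θ in (-Real.pi)..Real.pi, F r θ ^ 2 with hS₀
  set c₀' : ℝ → ℝ := fun r => ∫ θ in (-Real.pi)..Real.pi, Fr r θ with hc₀'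
  set c₁' : ℝ → ℝ := fun r => ∫ θ in (-Real.pi)..Real.pi, Fr r θ * Real.cos θ with hc₁'
  set c₂' : ℝ → ℝ := fun r => ∫ θ in (-Real.pi)..Real.pi, Fr r θ * Real.sin θ with hc₂'
  set C₀ : ℝ → ℝ := fun r => ∫ θ in (-Real.pi)..Real.pi, F r θ * Fr r θ with hC₀
  set N₀ : ℝ → ℝ := fun r => ∫ θ in (-Real.pi)..Real.pi, Fr r θ ^ 2 with hN₀
  set T₀ : ℝ → ℝ := fun r => ∫ θ in (-Real.pi)..Real.pi, Ft r θ ^ 2 with hT₀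
  have hder : ∀ r θ, HasDerivAt (fun r => F r θ) (Fr r θ) r := fun r θ => hasDerivAt_radial hφ r θ
  have hcos : Continuous fun p : ℝ × ℝ => Real.cos p.2 := by fun_prop
  have hsin : Continuous fun p : ℝ × ℝ => Real.sin p.2 := by fun_prop
  have dc₀ : ∀ r, HasDerivAt c₀ (c₀' r) r := hasDerivAt_angular_integral hder hFc hFrc
  have dc₁ : ∀ r, HasDerivAt c₁ (c₁' r) r :=
    hasDerivAt_angular_integral (fun r θ => (hder r θ).mul_const _) (hFc.mul hcos) (hFrc.mul hcos)
  have dc₂ : ∀ r, HasDerivAt c₂ (c₂' r) r :=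
    hasDerivAt_angular_integral (fun r θ => (hder r θ).mul_const _) (hFc.mul hsin) (hFrc.mul hsin)
  have dS₀ : ∀ r, HasDerivAt S₀ (2 * C₀ r) r := fun r => by
    have := hasDerivAt_angular_integral (G := fun r θ => F r θ ^ 2)
      (G' := fun r θ => 2 * (F r θ * Fr r θ))
      (fun r θ => ((hder r θ).fun_pow 2).congr_deriv (by norm_num; ring)) (hFc.pow 2)
      (show Continuous fun p : ℝ × ℝ => (2 : ℝ) * (Function.uncurry F p * Function.uncurry Fr p) from
        continuous_const.mul (hFc.mul hFrc)) r
    rwa [intervalIntegral.integral_const_mul] at this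
  have contOf : ∀ {f f' : ℝ → ℝ}, (∀ r, HasDerivAt f (f' r) r) → Continuous f := fun h =>
    continuous_iff_continuousAt.2 fun r => (h r).continuousAt
  have kc₀ := contOf dc₀
  have kc₁ := contOf dc₁
  have kc₂ := contOf dc₂
  have kS₀ := contOf dS₀
  -- partial masses
  set m₀ : ℝ → ℝ := fun r => ∫ ρ in (0 : ℝ)..r, ρ / 2 * c₀ ρ with hm₀
  set m₁ : ℝ → ℝ := fun r => ∫ ρ in (0 : ℝ)..r, ρ ^ 2 / 4 * c₁ ρ with hm₁
  set m₂ : ℝ → ℝ := fun r => ∫ ρ in (0 : ℝ)..r, ρ ^ 2 / 4 * c₂ ρ with hm₂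
  have dm₀ : ∀ r, HasDerivAt m₀ (r / 2 * c₀ r) r := fun r =>
    (by fun_prop : Continuous fun ρ => ρ / 2 * c₀ ρ).integral_hasStrictDerivAt 0 r |>.hasDerivAt
  have dm₁ : ∀ r, HasDerivAt m₁ (r ^ 2 / 4 * c₁ r) r := fun r =>
    (by fun_prop : Continuous fun ρ => ρ ^ 2 / 4 * c₁ ρ).integral_hasStrictDerivAt 0 r |>.hasDerivAt
  have dm₂ : ∀ r, HasDerivAt m₂ (r ^ 2 / 4 * c₂ r) r := fun r =>
    (by fun_prop : Continuous fun ρ => ρ ^ 2 / 4 * c₂ ρ).integral_hasStrictDerivAt 0 r |>.hasDerivAt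
  -- The final partial moments are ∫φ/2 and ∫xⱼφ/4, by ds = (r/2)dr and √s ds = (r²/4)dr.
  have m₀R : m₀ R = 0 := by
    have h := integral_mul_eq_polar hφ hR hsupp (w := fun _ => 1 / 2) continuous_const
    rw [integral_const_mul, h0, mul_zero] at h
    refine Eq.trans (intervalIntegral.integral_congr fun r _ => ?_) h.symm
    simp only [hc₀, ← intervalIntegral.integral_const_mul]
    refine intervalIntegral.integral_congr fun θ _ => ?_
    simp only [hFdef]
    ring
  have m₁R : m₁ R = 0 := by
    have h := integral_mul_eq_polar hφ hR hsupp (w := fun x => 1 / 4 * x 0) (by fun_prop)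
    simp only [mul_assoc] at h
    rw [integral_const_mul, h1, mul_zero] at h
    refine Eq.trans (intervalIntegral.integral_congr fun r _ => ?_) h.symm
    simp only [hc₁, ← intervalIntegral.integral_const_mul]
    refine intervalIntegral.integral_congr fun θ _ => ?_
    simp only [hFdef, PiLp.smul_apply, radialVec_apply_zero, smul_eq_mul]
    ring
  have m₂R : m₂ R = 0 := by
    have h := integral_mul_eq_polar hφ hR hsupp (w := fun x => 1 / 4 * x 1) (by fun_prop)
    simp only [mul_assoc] at h
    rw [integral_const_mul, h1, mul_zero] at h
    refine Eq.trans (intervalIntegral.integral_congr fun r _ => ?_) h.symm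
    simp only [hc₂, ← intervalIntegral.integral_const_mul]
    refine intervalIntegral.integral_congr fun θ _ => ?_
    simp only [hFdef, PiLp.smul_apply, radialVec_apply_one, smul_eq_mul]
    ring
  -- The angular integrals of f², f f_r and f_r² for the part f of φ without modes zero and one.
  set S : ℝ → ℝ := fun r =>
    S₀ r - (c₀ r ^ 2 / (2 * Real.pi) + (c₁ r ^ 2 + c₂ r ^ 2) / Real.pi) with hS
  set C : ℝ → ℝ := fun r =>
    C₀ r - (c₀ r * c₀' r / (2 * Real.pi) + (c₁ r * c₁' r + c₂ r * c₂' r) / Real.pi) with hC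
  set N : ℝ → ℝ := fun r =>
    N₀ r - (c₀' r ^ 2 / (2 * Real.pi) + (c₁' r ^ 2 + c₂' r ^ 2) / Real.pi) with hN
  have dS : ∀ r, HasDerivAt S (2 * C r) r := fun r => by
    refine ((dS₀ r).fun_sub ((((dc₀ r).fun_pow 2).div_const (2 * Real.pi)).fun_add
      ((((dc₁ r).fun_pow 2).fun_add ((dc₂ r).fun_pow 2)).div_const Real.pi))).congr_deriv ?_
    simp only [hC]
    norm_num
    ring
  have hbess : ∀ r p, 0 ≤ N r - 2 * p * C r + p ^ 2 * S r := fun r p => by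
    have k1 := hFθ r
    have k2 := hFrθ r
    have hb := bessel_circle (h := fun θ => Fr r θ - p * F r θ) (by fun_prop)
    have hi : ∀ {f : ℝ → ℝ}, Continuous f → IntervalIntegrable f volume (-Real.pi) Real.pi :=
      fun hf => hf.intervalIntegrable _ _
    have e0 : ∫ θ in (-Real.pi)..Real.pi, (Fr r θ - p * F r θ) = c₀' r - p * c₀ r := by
      rw [intervalIntegral.integral_sub (hi (by fun_prop)) (hi (by fun_prop)),
        intervalIntegral.integral_const_mul]
    have e1 : ∫ θ in (-Real.pi)..Real.pi, (Fr r θ - p * F r θ) * Real.cos θ =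
        c₁' r - p * c₁ r := by
      simp_rw [sub_mul, mul_assoc]
      rw [intervalIntegral.integral_sub (hi (by fun_prop)) (hi (by fun_prop)),
        intervalIntegral.integral_const_mul]
    have e2 : ∫ θ in (-Real.pi)..Real.pi, (Fr r θ - p * F r θ) * Real.sin θ =
        c₂' r - p * c₂ r := by
      simp_rw [sub_mul, mul_assoc]
      rw [intervalIntegral.integral_sub (hi (by fun_prop)) (hi (by fun_prop)),
        intervalIntegral.integral_const_mul]
    have e3 : ∫ θ in (-Real.pi)..Real.pi, (Fr r θ - p * F r θ) ^ 2 =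
        N₀ r + (-2 * p) * C₀ r + p ^ 2 * S₀ r := by
      have : ∀ θ, (Fr r θ - p * F r θ) ^ 2 =
        Fr r θ ^ 2 + (-2 * p) * (F r θ * Fr r θ) + p ^ 2 * F r θ ^ 2 := fun θ => by ring
      simp_rw [this]
      rw [intervalIntegral.integral_add (hi (by fun_prop)) (hi (by fun_prop)),
        intervalIntegral.integral_add (hi (by fun_prop)) (hi (by fun_prop)),
        intervalIntegral.integral_const_mul, intervalIntegral.integral_const_mul]
    rw [e0, e1, e2, e3, ← sub_nonneg] at hb
    refine hb.trans_eq ?_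
    simp only [hN, hC, hS]
    ring
  have hwirt : ∀ r, 4 * S₀ r - 2 / Real.pi * c₀ r ^ 2 - 3 / Real.pi * (c₁ r ^ 2 + c₂ r ^ 2) ≤
      r ^ 2 * T₀ r := fun r => by
    have k3 := hFtθ r
    have hw := wirtinger_circle (h := F r) (h' := fun θ => r * Ft r θ)
      (fun θ => hasDerivAt_angle hφ r θ) (by fun_prop) (by simp only [hFdef, radialVec_neg_pi])
    simp_rw [mul_pow] at hw
    rwa [intervalIntegral.integral_const_mul] at hw
  have hSnn : ∀ r, 0 ≤ S r := fun r => by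
    have := bessel_circle (hFθ r)
    simp only [hS]
    linarith
  -- the potential function
  set Φ : ℝ → ℝ := fun r => 1 / (2 * Real.pi) * potZero (r ^ 2 / 4) (c₀ r) (m₀ r)
    + 1 / Real.pi * (potOne (r ^ 2 / 4) (c₁ r) (m₁ r / r) + potOne (r ^ 2 / 4) (c₂ r) (m₂ r / r))
    + potTwo (r ^ 2 / 4) (S r) with hΦ
  have hΦc : Continuous Φ := by
    have k0 : Continuous fun r => potZero (r ^ 2 / 4) (c₀ r) (m₀ r) :=
      continuous_potZero.comp ((by fun_prop : Continuous fun r : ℝ => r ^ 2 / 4).prodMk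
        (kc₀.prodMk (contOf dm₀)))
    have k1 := continuous_potOne_comp kc₁
      (continuous_div_self_of_hasDerivAt dm₁ (by simp [hm₁]) (by simp))
    have k2 := continuous_potOne_comp kc₂
      (continuous_div_self_of_hasDerivAt dm₂ (by simp [hm₂]) (by simp))
    have k3 := continuous_potTwo_comp (contOf dS)
    fun_prop
  -- Although c₀(0) may be nonzero, the factor eˢ - 1 vanishes. The quotients m/r take the default
  -- value 0/0 = 0, which is also their limit.
  have hΦ0 : Φ 0 = 0 := by
    have z : ∀ θ, F 0 θ = φ 0 := fun θ => by simp [hFdef]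
    have z0 : c₀ 0 = 2 * Real.pi * φ 0 := by
      simp only [hc₀, z, intervalIntegral.integral_const, smul_eq_mul]; ring
    have z1 : c₁ 0 = 0 := by simp [hc₁, z]
    have z2 : c₂ 0 = 0 := by simp [hc₂, z]
    have z3 : S₀ 0 = 2 * Real.pi * φ 0 ^ 2 := by
      simp only [hS₀, z, intervalIntegral.integral_const, smul_eq_mul]; ring
    have z4 : S 0 = 0 := by
      simp only [hS, z0, z1, z2, z3]
      field_simp
      ring
    have z5 : m₀ 0 = 0 := by simp [hm₀]
    simp only [hΦ, z1, z2, z4, z5]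
    simp [potZero, potOne, potTwo]
  have hΦR : Φ R = 0 := by
    have z : ∀ θ, F R θ = 0 := fun θ => hFz R θ le_rfl
    have z0 : c₀ R = 0 := by simp [hc₀, z]
    have z1 : c₁ R = 0 := by simp [hc₁, z]
    have z2 : c₂ R = 0 := by simp [hc₂, z]
    have z3 : S₀ R = 0 := by simp [hS₀, z]
    have z4 : S R = 0 := by simp [hS, z0, z1, z2, z3]
    simp only [hΦ, z0, z1, z2, z4, m₀R, m₁R, m₂R]
    simp [potZero, potOne, potTwo]
  have hout : ∀ x, R < ‖x‖ → coerciveDensity φ x = 0 := fun x hx => by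
    have h2 : φ =ᶠ[𝓝 x] fun _ => 0 := by
      filter_upwards [(isOpen_lt continuous_const continuous_norm).mem_nhds hx] with y hy
      exact hsupp y (le_of_lt hy)
    have h3 : gradient φ x = 0 := by
      rw [gradient, h2.fderiv_eq]
      simp
    simp [coerciveDensity, h3, hsupp x hx.le]
  obtain ⟨hPint, hPeq⟩ := integral_plane_eq_polar hR.le hout (integrableOn_coerciveDensity hφ R)
  rw [hPeq]
  have hP : ∀ r, 0 < r → ∫ θ in (-Real.pi)..Real.pi, r * coerciveDensity φ (r • radialVec θ) =
      r * (profA (r ^ 2 / 4) * N₀ r + profA (r ^ 2 / 4) * T₀ r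
        - (profB (r ^ 2 / 4) + 1 / 1000 * profA (r ^ 2 / 4)) * S₀ r) := fun r _ => by
    have k1 := hFθ r
    have k2 := hFrθ r
    have k3 := hFtθ r
    have hi : ∀ {f : ℝ → ℝ}, Continuous f → IntervalIntegrable f volume (-Real.pi) Real.pi :=
      fun hf => hf.intervalIntegrable _ _
    have e : ∀ θ, coerciveDensity φ (r • radialVec θ) =
        profA (r ^ 2 / 4) * Fr r θ ^ 2 + profA (r ^ 2 / 4) * Ft r θ ^ 2
        - (profB (r ^ 2 / 4) + 1 / 1000 * profA (r ^ 2 / 4)) * F r θ ^ 2 := fun θ => by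
      rw [coerciveDensity, norm_smul_radialVec, norm_gradient_sq φ _ θ, mul_add]
    simp_rw [e]
    rw [intervalIntegral.integral_const_mul,
      intervalIntegral.integral_sub (hi (by fun_prop)) (hi (by fun_prop)),
      intervalIntegral.integral_add (hi (by fun_prop)) (hi (by fun_prop)),
      intervalIntegral.integral_const_mul, intervalIntegral.integral_const_mul,
      intervalIntegral.integral_const_mul]
  have hbound : ∀ r, 0 < r → ∃ d, HasDerivAt Φ d r ∧
      d ≤ ∫ θ in (-Real.pi)..Real.pi, r * coerciveDensity φ (r • radialVec θ) := fun r hr => by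
    obtain ⟨d₀, hd₀, hle₀⟩ := exists_hasDerivAt_potZero_le hr (dc₀ r) (dm₀ r)
    obtain ⟨d₁, hd₁, hle₁⟩ := exists_hasDerivAt_potOne_le hr (dc₁ r) (dm₁ r)
    obtain ⟨d₂, hd₂, hle₂⟩ := exists_hasDerivAt_potOne_le hr (dc₂ r) (dm₂ r)
    obtain ⟨d₃, hd₃, hle₃⟩ := exists_hasDerivAt_potTwo_le hr (dS r) (hSnn r) (hbess r)
    refine ⟨_, ((hd₀.const_mul (1 / (2 * Real.pi))).fun_add
      ((hd₁.fun_add hd₂).const_mul (1 / Real.pi))).fun_add hd₃, ?_⟩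
    rw [hP r hr]
    have hA0 : 0 ≤ profA (r ^ 2 / 4) := zero_le_one.trans (one_le_profA (by positivity))
    -- The Wirtinger lower bound equals 4S + (c₁² + c₂²)/π, the angular energies required by the
    -- potentials of the higher and first modes.
    have hT := mul_le_mul_of_nonneg_left (hwirt r) (by positivity : 0 ≤ profA (r ^ 2 / 4) / r)
    have e0 := mul_le_mul_of_nonneg_left hle₀ (by positivity : 0 ≤ 1 / (2 * Real.pi))
    have e1 := mul_le_mul_of_nonneg_left (add_le_add hle₁ hle₂) (by positivity : 0 ≤ 1 / Real.pi)
    refine (add_le_add (add_le_add e0 e1) hle₃).trans ?_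
    rw [← sub_nonneg] at hT ⊢
    refine hT.trans_eq ?_
    simp only [hS, hN]
    field_simp
    ring
  -- Differentiability is needed only for r > 0; continuity handles the endpoint 0.
  choose! d hd hdle using hbound
  have := intervalIntegral.sub_le_integral_of_hasDeriv_right_of_le hR.le hΦc.continuousOn
    (fun r hr => (hd r hr.1).hasDerivWithinAt) hPint (fun r hr => hdle r hr.1)
  rwa [hΦ0, hΦR, sub_zero] at this

end Smooth

end

/-! ### Mollification in L² -/

section

open MeasureTheory Filter Topology ENNReal

/-- Jensen's inequality for the square and a density of total mass one. -/
theorem lintegral_mul_rpow_two_le {α : Type*} [MeasurableSpace α] {μ : Measure α}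
    {ρ g : α → ℝ≥0∞} (hρ : AEMeasurable ρ μ) (hg : AEMeasurable g μ) (h1 : ∫⁻ t, ρ t ∂μ = 1) :
    (∫⁻ t, ρ t * g t ∂μ) ^ (2 : ℝ) ≤ ∫⁻ t, ρ t * g t ^ (2 : ℝ) ∂μ := by
  have h := ENNReal.lintegral_mul_le_Lp_mul_Lq μ Real.HolderConjugate.two_two
    (hρ.pow_const (1 / 2 : ℝ)) ((hρ.pow_const (1 / 2 : ℝ)).mul hg)
  have e1 : ∀ t, ρ t ^ (1 / 2 : ℝ) * (ρ t ^ (1 / 2 : ℝ) * g t) = ρ t * g t := fun t => by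
    rw [← mul_assoc, ← ENNReal.rpow_add_of_nonneg _ _ (by norm_num) (by norm_num)]
    norm_num
  have e2 : ∀ t, (ρ t ^ (1 / 2 : ℝ)) ^ (2 : ℝ) = ρ t := fun t => by
    rw [← ENNReal.rpow_mul]
    norm_num
  have e3 : ∀ t, (ρ t ^ (1 / 2 : ℝ) * g t) ^ (2 : ℝ) = ρ t * g t ^ (2 : ℝ) := fun t => by
    rw [ENNReal.mul_rpow_of_nonneg _ _ (by norm_num), e2]
  simp only [Pi.mul_apply, e1, e2, e3, h1, ENNReal.one_rpow, one_mul] at h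
  calc (∫⁻ t, ρ t * g t ∂μ) ^ (2 : ℝ)
      ≤ ((∫⁻ t, ρ t * g t ^ (2 : ℝ) ∂μ) ^ (1 / 2 : ℝ)) ^ (2 : ℝ) :=
        ENNReal.rpow_le_rpow h (by norm_num)
    _ = _ := by rw [← ENNReal.rpow_mul]; norm_num

section Mollify

variable {E F : Type*} [NormedAddCommGroup E] [NormedSpace ℝ E] [FiniteDimensional ℝ E]
  [MeasurableSpace E] (μ : Measure E) [NormedAddCommGroup F] [NormedSpace ℝ F]

/-- Mollification by a normalized bump function. -/
def mollify (ρ : ContDiffBump (0 : E)) (h : E → F) (x : E) : F :=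
  convolution (ρ.normed μ) h (ContinuousLinearMap.lsmul ℝ ℝ) μ x

variable {μ}

theorem mollify_apply (ρ : ContDiffBump (0 : E)) (h : E → F) (x : E) :
    mollify μ ρ h x = ∫ t, ρ.normed μ t • h (x - t) ∂μ := rfl

variable [BorelSpace E] [μ.IsAddHaarMeasure]

theorem mollify_apply_swap (ρ : ContDiffBump (0 : E)) (h : E → F) (x : E) :
    mollify μ ρ h x = ∫ t, ρ.normed μ (x - t) • h t ∂μ := convolution_lsmul_swap

theorem contDiff_mollify (ρ : ContDiffBump (0 : E)) {h : E → F} (hh : LocallyIntegrable h μ) :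
    ContDiff ℝ ((⊤ : ℕ∞) : WithTop ℕ∞) (mollify μ ρ h) :=
  ρ.hasCompactSupport_normed.contDiff_convolution_left _ ρ.contDiff_normed hh

/-- Mollification does not increase the `L²` norm. -/
theorem eLpNorm_mollify_le (ρ : ContDiffBump (0 : E)) {h : E → F}
    (hh : AEStronglyMeasurable h μ) : eLpNorm (mollify μ ρ h) 2 μ ≤ eLpNorm h 2 μ := by
  have hm : Measurable fun t => ‖ρ.normed μ t‖ₑ := ρ.continuous_normed.measurable.enorm
  have h1 : ∫⁻ t, ‖ρ.normed μ t‖ₑ ∂μ = 1 := by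
    rw [← ofReal_integral_norm_eq_lintegral_enorm ρ.integrable_normed]
    simp_rw [Real.norm_of_nonneg (ρ.nonneg_normed _), ρ.integral_normed]
    simp
  have hsub : AEStronglyMeasurable (fun p : E × E => h (p.1 - p.2)) (μ.prod μ) :=
    hh.comp_quasiMeasurePreserving (quasiMeasurePreserving_sub_of_right_invariant μ μ)
  have hpt : ∀ x, ‖mollify μ ρ h x‖ₑ ^ (2 : ℝ) ≤
      ∫⁻ t, ‖ρ.normed μ t‖ₑ * ‖h (x - t)‖ₑ ^ (2 : ℝ) ∂μ := fun x => by
    have hx : AEStronglyMeasurable (fun t => h (x - t)) μ :=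
      hh.comp_quasiMeasurePreserving (quasiMeasurePreserving_sub_left_of_right_invariant μ x)
    refine le_trans (ENNReal.rpow_le_rpow ?_ (by norm_num))
      (lintegral_mul_rpow_two_le hm.aemeasurable hx.enorm h1)
    rw [mollify_apply]
    refine (enorm_integral_le_lintegral_enorm _).trans_eq ?_
    simp_rw [enorm_smul]
  rw [eLpNorm_eq_lintegral_rpow_enorm_toReal two_ne_zero ofNat_ne_top,
    eLpNorm_eq_lintegral_rpow_enorm_toReal two_ne_zero ofNat_ne_top]
  refine ENNReal.rpow_le_rpow ?_ (by positivity)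
  simp only [toReal_ofNat]
  calc ∫⁻ x, ‖mollify μ ρ h x‖ₑ ^ (2 : ℝ) ∂μ
      ≤ ∫⁻ x, ∫⁻ t, ‖ρ.normed μ t‖ₑ * ‖h (x - t)‖ₑ ^ (2 : ℝ) ∂μ ∂μ := lintegral_mono hpt
    _ = ∫⁻ t, ∫⁻ x, ‖ρ.normed μ t‖ₑ * ‖h (x - t)‖ₑ ^ (2 : ℝ) ∂μ ∂μ := by
        refine lintegral_lintegral_swap ?_
        exact (hm.comp measurable_snd).aemeasurable.mul (hsub.enorm.pow_const _)
    _ = ∫⁻ t, ‖ρ.normed μ t‖ₑ * ∫⁻ x, ‖h x‖ₑ ^ (2 : ℝ) ∂μ ∂μ := by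
        refine lintegral_congr fun t => ?_
        rw [lintegral_const_mul' _ _ enorm_ne_top,
          lintegral_sub_right_eq_self (fun x => ‖h x‖ₑ ^ (2 : ℝ)) t]
    _ = ∫⁻ x, ‖h x‖ₑ ^ (2 : ℝ) ∂μ := by
        rw [lintegral_mul_const _ hm, h1, one_mul]

theorem mollify_sub (ρ : ContDiffBump (0 : E)) {h k : E → F} (hh : LocallyIntegrable h μ)
    (hk : LocallyIntegrable k μ) : mollify μ ρ (h - k) = mollify μ ρ h - mollify μ ρ k := by
  have hex : ∀ {f : E → F}, LocallyIntegrable f μ → ∀ x,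
      Integrable (fun t => ρ.normed μ t • f (x - t)) μ := fun hf x =>
    ρ.hasCompactSupport_normed.convolutionExists_left (ContinuousLinearMap.lsmul ℝ ℝ)
      ρ.continuous_normed hf x
  ext x
  simp only [mollify_apply, Pi.sub_apply, smul_sub]
  exact integral_sub (hex hh x) (hex hk x)

theorem support_mollify_subset (ρ : ContDiffBump (0 : E)) {h : E → F} {R : ℝ}
    (hh : ∀ x, R < ‖x‖ → h x = 0) {x : E} (hx : R + ρ.rOut < ‖x‖) : mollify μ ρ h x = 0 := by
  rw [mollify_apply]
  refine integral_eq_zero_of_ae (.of_forall fun t => ?_)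
  by_cases ht : t ∈ Metric.ball (0 : E) ρ.rOut
  · have : R < ‖x - t‖ := by
      have h1 := norm_sub_norm_le x t
      have h2 : ‖t‖ < ρ.rOut := by simpa using ht
      linarith
    simp [hh _ this]
  · rw [← ρ.support_normed_eq (μ := μ), Function.notMem_support] at ht
    simp [ht]

/-- Mollifications converge in `L²`. -/
theorem exists_eLpNorm_mollify_sub_le [CompleteSpace F] {h : E → F} (hh : MemLp h 2 μ)
    {ε : ℝ≥0∞} (hε : ε ≠ 0) :
    ∃ δ : ℝ, 0 < δ ∧ ∀ ρ : ContDiffBump (0 : E), ρ.rOut ≤ δ →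
      eLpNorm (mollify μ ρ h - h) 2 μ ≤ ε := by
  have hε3 : ε / 3 ≠ 0 := by simp [hε]
  obtain ⟨k, hkc, hk, hkcont, hkL⟩ := hh.exists_hasCompactSupport_eLpNorm_sub_le ofNat_ne_top hε3
  have hkuc := hkc.uniformContinuous_of_continuous hkcont
  obtain ⟨R, hR⟩ := hkc.isBounded.exists_norm_le
  have hkz : ∀ x, R < ‖x‖ → k x = 0 := fun x hx => by
    by_contra hne
    exact (hR x (subset_tsupport k hne)).not_gt hx
  set s : Set E := Metric.closedBall 0 (R + 1) with hs
  have hsfin : μ s ^ (1 / (2 : ℝ≥0∞).toReal) ≠ ∞ :=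
    ENNReal.rpow_ne_top_of_nonneg (by positivity) measure_closedBall_lt_top.ne
  obtain ⟨η, hη, hηle⟩ : ∃ η : ℝ, 0 < η ∧
      ENNReal.ofReal η * μ s ^ (1 / (2 : ℝ≥0∞).toReal) ≤ ε / 3 := by
    have ht : Tendsto (fun η : ℝ => ENNReal.ofReal η * μ s ^ (1 / (2 : ℝ≥0∞).toReal)) (𝓝[>] 0)
        (𝓝 0) := by
      have h0 : Tendsto (fun η : ℝ => ENNReal.ofReal η) (𝓝[>] 0) (𝓝 0) := by
        simpa using (ENNReal.continuous_ofReal.tendsto (0 : ℝ)).mono_left nhdsWithin_le_nhds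
      simpa using ENNReal.Tendsto.mul_const h0 (Or.inr hsfin)
    have := (ht.eventually_le_const (pos_iff_ne_zero.2 hε3)).and self_mem_nhdsWithin
    obtain ⟨η, h1, h2⟩ := this.exists
    exact ⟨η, h2, h1⟩
  obtain ⟨δ, hδ, hδk⟩ := Metric.uniformContinuous_iff.1 hkuc η hη
  refine ⟨min δ 1, by positivity, fun ρ hρ => ?_⟩
  have hhl : LocallyIntegrable h μ := hh.locallyIntegrable (by norm_num)
  have hkl : LocallyIntegrable k μ := hkcont.locallyIntegrable
  -- Three-epsilon argument: k is uniformly continuous, and mollification contracts the L² norm of h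
  -- - k.
  have hdec : mollify μ ρ h - h = mollify μ ρ (h - k) + ((mollify μ ρ k - k) - (h - k)) := by
    rw [mollify_sub ρ hhl hkl]
    abel
  have a0 : AEStronglyMeasurable (h - k) μ := hh.aestronglyMeasurable.sub hkL.aestronglyMeasurable
  have a1 : AEStronglyMeasurable (mollify μ ρ (h - k)) μ :=
    (contDiff_mollify ρ (hhl.sub hkl)).continuous.aestronglyMeasurable
  have a2 : AEStronglyMeasurable (mollify μ ρ k - k) μ :=
    (contDiff_mollify ρ hkl).continuous.aestronglyMeasurable.sub hkL.aestronglyMeasurable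
  have hmid : eLpNorm (mollify μ ρ k - k) 2 μ ≤ ε / 3 := by
    refine le_trans (eLpNorm_sub_le_of_dist_bdd μ ofNat_ne_top measurableSet_closedBall hη.le
      (s := s) (fun x => ?_) (fun x hx => ?_) (fun x hx => ?_)) hηle
    · refine ρ.dist_normed_convolution_le hkcont.aestronglyMeasurable fun y hy => (hδk ?_).le
      exact (Metric.mem_ball.1 hy).trans_le (hρ.trans (min_le_left _ _))
    · by_contra hns
      rw [hs, mem_closedBall_zero_iff, not_le] at hns
      exact hx (support_mollify_subset ρ hkz (by linarith [hρ.trans (min_le_right δ 1)]))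
    · by_contra hns
      rw [hs, mem_closedBall_zero_iff, not_le] at hns
      exact hx (hkz x (by linarith))
  calc eLpNorm (mollify μ ρ h - h) 2 μ
      ≤ eLpNorm (mollify μ ρ (h - k)) 2 μ + (eLpNorm (mollify μ ρ k - k) 2 μ
        + eLpNorm (h - k) 2 μ) := by
        rw [hdec]
        refine (eLpNorm_add_le a1 (a2.sub a0) (by norm_num)).trans ?_
        gcongr
        exact eLpNorm_sub_le a2 a0 (by norm_num)
    _ ≤ ε / 3 + (ε / 3 + ε / 3) := by
        gcongr
        exact (eLpNorm_mollify_le ρ a0).trans hk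
    _ = ε := by rw [← add_assoc, ENNReal.add_thirds]

end Mollify

end

/-! ### Weak gradients -/

section

open MeasureTheory Filter Topology ENNReal

theorem integral_apply_plane {g : Plane → Plane} (hg : Integrable g) (j : Fin 2) :
    (∫ x, g x) j = ∫ x, g x j :=
  ((EuclideanSpace.proj (𝕜 := ℝ) j).integral_comp_comm hg).symm

theorem fderiv_mollify_apply (ρ : ContDiffBump (0 : Plane)) {ω : Plane → ℝ}
    (hω : LocallyIntegrable ω) (x v : Plane) :
    fderiv ℝ (mollify volume ρ ω) x v =
      ∫ t, ω t * fderiv ℝ (ρ.normed volume) (x - t) v := by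
  have hflip : mollify volume ρ ω =
      convolution ω (ρ.normed volume) (ContinuousLinearMap.lsmul ℝ ℝ).flip volume :=
    (convolution_flip (L := ContinuousLinearMap.lsmul ℝ ℝ) (f := ρ.normed volume) (g := ω)
      (μ := volume)).symm
  have hρ1 : ContDiff ℝ 1 (ρ.normed (volume : Measure Plane)) := ρ.contDiff_normed (n := 1)
  have h := ρ.hasCompactSupport_normed.hasFDerivAt_convolution_right
    (μ := (volume : Measure Plane)) (ContinuousLinearMap.lsmul ℝ ℝ).flip hω hρ1 x
  rw [hflip, h.fderiv, convolution_precompR_apply _ hω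
    (ρ.hasCompactSupport_normed.fderiv ℝ) (hρ1.continuous_fderiv one_ne_zero)]
  refine integral_congr_ae (.of_forall fun t => ?_)
  simp [mul_comm]

/-- The gradient of a mollified function is the mollified weak gradient. -/
theorem gradient_mollify {ω : Plane → ℝ} {g : Plane → Plane} (h : HasWeakGradient ω g)
    (ρ : ContDiffBump (0 : Plane)) :
    gradient (mollify volume ρ ω) = mollify volume ρ g := by
  obtain ⟨hω, hg, hweak⟩ := h
  ext x j
  have hsm : ContDiff ℝ ((⊤ : ℕ∞) : WithTop ℕ∞) (ρ.normed (volume : Measure Plane)) :=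
    ρ.contDiff_normed
  -- The reflected and translated kernel serves as the test function.
  set ψ : Plane → ℝ := fun t => ρ.normed volume (x - t) with hψ
  have hψs : ContDiff ℝ ((⊤ : ℕ∞) : WithTop ℕ∞) ψ := hsm.comp (contDiff_const.sub contDiff_id)
  have hψc : HasCompactSupport ψ :=
    ρ.hasCompactSupport_normed.comp_homeomorph (Homeomorph.subLeft x)
  have hψd : ∀ t v, fderiv ℝ ψ t v = -fderiv ℝ (ρ.normed volume) (x - t) v := fun t v => by
    have h1 : HasFDerivAt (fun t : Plane => x - t) (-ContinuousLinearMap.id ℝ Plane) t :=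
      (hasFDerivAt_id t).const_sub x
    have h2 := ((hsm.differentiable (by simp)) (x - t)).hasFDerivAt.comp t h1
    rw [hψ, show (fun t => ρ.normed volume (x - t)) = ρ.normed volume ∘ fun t => x - t from rfl,
      h2.fderiv]
    simp
  have key := hweak ψ hψs hψc j
  simp only [hψd, mul_neg, integral_neg, neg_inj] at key
  rw [gradient_apply, fderiv_mollify_apply ρ hω, key, mollify_apply_swap, integral_apply_plane]
  · simp [hψ]
  · exact hg.integrable_smul_left_of_hasCompactSupport hψs.continuous hψc

theorem continuous_gradient {χ : Plane → ℝ} (hχ : ContDiff ℝ 1 χ) : Continuous (gradient χ) :=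
  (InnerProductSpace.toDual ℝ Plane).symm.continuous.comp (hχ.continuous_fderiv one_ne_zero)

/-- Product rule for weak gradients. -/
theorem HasWeakGradient.smooth_mul {ω : Plane → ℝ} {g : Plane → Plane} (h : HasWeakGradient ω g)
    {χ : Plane → ℝ} (hχ : ContDiff ℝ ((⊤ : ℕ∞) : WithTop ℕ∞) χ) :
    HasWeakGradient (fun x => χ x * ω x) (fun x => χ x • g x + ω x • gradient χ x) := by
  obtain ⟨hω, hg, hweak⟩ := h
  have hχ1 : ContDiff ℝ 1 χ := hχ.of_le (by simp)
  have hgr := continuous_gradient hχ1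
  refine ⟨hω.continuous_mul hχ.continuous, (hg.continuous_smul hχ.continuous).add
    (hω.smul_continuous hgr), fun φ hφ hφc j => ?_⟩
  have hφ1 : ContDiff ℝ 1 φ := hφ.of_le (by simp)
  set e : Plane := EuclideanSpace.single j 1 with he
  have hprod : ∀ x, fderiv ℝ (fun x => χ x * φ x) x e =
      χ x * fderiv ℝ φ x e + φ x * gradient χ x j := fun x => by
    rw [fderiv_fun_mul (hχ1.differentiable one_ne_zero x) (hφ1.differentiable one_ne_zero x),
      gradient_apply]
    simp [he]
  have key := hweak (fun x => χ x * φ x) (hχ.mul hφ) (hφc.mul_left) j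
  have hgrj : Continuous fun x => gradient χ x j := by fun_prop
  have hφd : Continuous fun x => fderiv ℝ φ x e := by
    have := hφ1.continuous_fderiv one_ne_zero
    fun_prop
  have i1 : Integrable fun x => ω x * (χ x * fderiv ℝ φ x e) :=
    hω.integrable_smul_right_of_hasCompactSupport (hχ.continuous.mul hφd)
      ((hφc.fderiv_apply ℝ e).mul_left)
  have i2 : Integrable fun x => ω x * (φ x * gradient χ x j) :=
    hω.integrable_smul_right_of_hasCompactSupport (hφ.continuous.mul hgrj) hφc.mul_right
  have hgj : LocallyIntegrable fun x => g x j := fun x => by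
    obtain ⟨s, hs, hi⟩ := hg x
    exact ⟨s, hs, (EuclideanSpace.proj (𝕜 := ℝ) j).integrable_comp hi⟩
  have i3 : Integrable fun x => (χ x * φ x) * g x j :=
    hgj.integrable_smul_left_of_hasCompactSupport (hχ.continuous.mul hφ.continuous) hφc.mul_left
  calc ∫ x, χ x * ω x * fderiv ℝ φ x e
      = ∫ x, (ω x * fderiv ℝ (fun x => χ x * φ x) x e - ω x * (φ x * gradient χ x j)) := by
        refine integral_congr_ae (.of_forall fun x => ?_)
        simp only [hprod]
        ring
    _ = (∫ x, ω x * fderiv ℝ (fun x => χ x * φ x) x e) - ∫ x, ω x * (φ x * gradient χ x j) := by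
        refine integral_sub ?_ i2
        simp_rw [hprod, mul_add]
        exact i1.add i2
    _ = -((∫ x, (χ x * φ x) * g x j) + ∫ x, ω x * (φ x * gradient χ x j)) := by
        rw [key]
        ring
    _ = -∫ x, φ x * (χ x • g x + ω x • gradient χ x) j := by
        rw [← integral_add i3 i2]
        congr 1
        refine integral_congr_ae (.of_forall fun x => ?_)
        simp
        ring

/-- Weak gradients are unique. -/
theorem HasWeakGradient.ae_eq {ω : Plane → ℝ} {g g' : Plane → Plane} (h : HasWeakGradient ω g)
    (h' : HasWeakGradient ω g') : g =ᵐ[volume] g' := by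
  refine ae_eq_of_integral_contDiff_smul_eq h.2.1 h'.2.1 fun φ hφ hφc => ?_
  have i := h.2.1.integrable_smul_left_of_hasCompactSupport hφ.continuous hφc
  have i' := h'.2.1.integrable_smul_left_of_hasCompactSupport hφ.continuous hφc
  ext j
  rw [integral_apply_plane i, integral_apply_plane i']
  have e1 := h.2.2 φ hφ hφc j
  have e2 := h'.2.2 φ hφ hφc j
  have := neg_injective (e1.symm.trans e2)
  simpa using this

/-- Dominated convergence to zero in `L²`. -/
theorem tendsto_eLpNorm_two_of_dominated {α F : Type*} [MeasurableSpace α] {μ : Measure α}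
    [NormedAddCommGroup F] {f : ℕ → α → F} {b : α → ℝ} (hb : MemLp b 2 μ)
    (hf : ∀ n, AEStronglyMeasurable (f n) μ) (hbound : ∀ n x, ‖f n x‖ ≤ b x)
    (hlim : ∀ x, Tendsto (fun n => f n x) atTop (𝓝 0)) :
    Tendsto (fun n => eLpNorm (f n) 2 μ) atTop (𝓝 0) := by
  have h := tendsto_lintegral_of_dominated_convergence' (μ := μ)
    (F := fun n x => ‖f n x‖ₑ ^ (2 : ℝ)) (f := fun _ => 0) (fun x => ‖b x‖ₑ ^ (2 : ℝ))
    (fun n => (hf n).enorm.pow_const _) (fun n => .of_forall fun x => ?_) ?_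
    (.of_forall fun x => ?_)
  · have e : ∀ n, eLpNorm (f n) 2 μ = (∫⁻ x, ‖f n x‖ₑ ^ (2 : ℝ) ∂μ) ^ (1 / (2 : ℝ)) := fun n => by
      rw [eLpNorm_eq_lintegral_rpow_enorm_toReal two_ne_zero ofNat_ne_top]
      simp
    simp_rw [e]
    have h2 := (ENNReal.continuous_rpow_const (y := 1 / (2 : ℝ))).tendsto 0 |>.comp
      (by simpa using h)
    simpa [Function.comp_def] using h2
  · refine ENNReal.rpow_le_rpow ?_ (by norm_num)
    refine enorm_le_iff_norm_le.2 ((hbound n x).trans (le_abs_self _))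
  · have := hb.eLpNorm_lt_top
    rw [eLpNorm_lt_top_iff_lintegral_rpow_enorm_lt_top two_ne_zero ofNat_ne_top] at this
    simpa using this.ne
  · have h2 := (ENNReal.continuous_rpow_const (y := (2 : ℝ))).tendsto 0 |>.comp
      (tendsto_zero_iff_enorm_tendsto_zero.1 (hlim x))
    simpa [Function.comp_def] using h2

end

/-! ### Density of test functions in the weighted norms -/

section

open MeasureTheory Filter Topology ENNReal

variable {F : Type*} [NormedAddCommGroup F] [NormedSpace ℝ F]

/-- Multiplication by the square root of the weight `𝒜`. -/
def weighted (h : Plane → F) (x : Plane) : F := √(calA x) • h x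

theorem continuous_sqrt_calA : Continuous fun x => √(calA x) := continuous_calA.sqrt

theorem one_le_sqrt_calA (x : Plane) : 1 ≤ √(calA x) := Real.one_le_sqrt.2 (one_le_calA x)

theorem weighted_add (h k : Plane → F) : weighted (h + k) = weighted h + weighted k := by
  ext x
  simp [weighted]

theorem weighted_sub (h k : Plane → F) : weighted (h - k) = weighted h - weighted k := by
  ext x
  simp [weighted, smul_sub]

theorem weighted_const_smul (c : ℝ) (h : Plane → F) : weighted (c • h) = c • weighted h := by
  ext x
  simp [weighted, smul_comm c]

theorem norm_weighted (h : Plane → F) (x : Plane) : ‖weighted h x‖ = √(calA x) * ‖h x‖ := by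
  rw [weighted, norm_smul, Real.norm_of_nonneg (Real.sqrt_nonneg _)]

theorem aestronglyMeasurable_weighted {h : Plane → F} (hh : AEStronglyMeasurable h volume) :
    AEStronglyMeasurable (weighted h) volume :=
  continuous_sqrt_calA.aestronglyMeasurable.smul hh

theorem memLp_of_weighted {h : Plane → F} (hh : MemLp (weighted h) 2 volume) :
    MemLp h 2 volume := by
  have hm : AEStronglyMeasurable h volume := by
    have : h = fun x => (√(calA x))⁻¹ • weighted h x := by
      ext x
      rw [weighted, inv_smul_smul₀ (zero_lt_one.trans_le (one_le_sqrt_calA x)).ne']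
    rw [this]
    exact (continuous_sqrt_calA.inv₀ fun x =>
      (zero_lt_one.trans_le (one_le_sqrt_calA x)).ne').aestronglyMeasurable.smul hh.1
  refine hh.mono hm (.of_forall fun x => ?_)
  rw [norm_weighted]
  exact le_mul_of_one_le_left (norm_nonneg _) (one_le_sqrt_calA x)

theorem memLp_weighted_of_hasCompactSupport {h : Plane → F} (hh : Continuous h)
    (hc : HasCompactSupport h) : MemLp (weighted h) 2 volume :=
  (continuous_sqrt_calA.smul hh).memLp_of_hasCompactSupport hc.smul_left

/-- Smooth cutoffs approximate in the weighted norms. -/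
theorem exists_cutoff {ω : Plane → ℝ} {g : Plane → Plane}
    (hω : MemLp (weighted ω) 2 volume) (hg : MemLp (weighted g) 2 volume) {ε : ℝ≥0∞}
    (hε : ε ≠ 0) :
    ∃ χ : Plane → ℝ, ContDiff ℝ ((⊤ : ℕ∞) : WithTop ℕ∞) χ ∧ HasCompactSupport χ ∧
      eLpNorm (weighted ((fun x => χ x * ω x) - ω)) 2 volume ≤ ε ∧
      eLpNorm (weighted ((fun x => χ x • g x + ω x • gradient χ x) - g)) 2 volume ≤ ε := by
  let b : ContDiffBump (0 : Plane) := ⟨1, 2, one_pos, one_lt_two⟩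
  have hbs : ContDiff ℝ ((⊤ : ℕ∞) : WithTop ℕ∞) b := b.contDiff
  have hb1 : ContDiff ℝ 1 b := b.contDiff
  have hgc : HasCompactSupport (gradient b) :=
    (b.hasCompactSupport.fderiv ℝ).comp_left (map_zero (InnerProductSpace.toDual ℝ Plane).symm)
  obtain ⟨C, hC⟩ := hgc.exists_bound_of_continuous (continuous_gradient hb1)
  have hC0 : 0 ≤ C := (norm_nonneg _).trans (hC 0)
  let c : ℕ → ℝ := fun n => 1 / ((n : ℝ) + 1)
  have hc0 : ∀ n, 0 < c n := fun n => Nat.one_div_pos_of_nat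
  have hc1 : ∀ n, c n ≤ 1 := fun n => by
    have := Nat.one_div_le_one_div (α := ℝ) (Nat.zero_le n)
    simpa [c] using this
  -- The cutoffs b(x/(n + 1)) have gradients of size at most C/(n + 1), so the commutator term ω∇χ
  -- disappears in the limit.
  have hclim : Tendsto c atTop (𝓝 0) := tendsto_one_div_add_atTop_nhds_zero_nat
  let χ : ℕ → Plane → ℝ := fun n x => b (c n • x)
  have hχs : ∀ n, ContDiff ℝ ((⊤ : ℕ∞) : WithTop ℕ∞) (χ n) := fun n =>
    hbs.comp (contDiff_const_smul (c n))
  have hχc : ∀ n, HasCompactSupport (χ n) := fun n =>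
    b.hasCompactSupport.comp_homeomorph (Homeomorph.smulOfNeZero (c n) (hc0 n).ne')
  have hgrad : ∀ n x, gradient (χ n) x = c n • gradient b (c n • x) := fun n x => by
    have h := fderiv_comp_smul (𝕜 := ℝ) (f := (b : Plane → ℝ)) (x := x) (c n)
    rw [gradient, show χ n = (b <| c n • ·) from rfl, h, map_smul, gradient]
  have hgle : ∀ n x, ‖gradient (χ n) x‖ ≤ c n * C := fun n x => by
    rw [hgrad, norm_smul, Real.norm_of_nonneg (hc0 n).le]
    exact mul_le_mul_of_nonneg_left (hC _) (hc0 n).le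
  have hχ1 : ∀ n x, |χ n x - 1| ≤ 1 := fun n x => by
    have h1 : 0 ≤ χ n x := b.nonneg
    have h2 : χ n x ≤ 1 := b.le_one
    rw [abs_le]
    constructor <;> linarith
  have hχlim : ∀ x, Tendsto (fun n => χ n x - 1) atTop (𝓝 0) := fun x => by
    have h1 : Tendsto (fun n => c n • x) atTop (𝓝 0) := by
      simpa using hclim.smul_const x
    have h2 := (b.continuous.tendsto 0).comp h1
    have h3 : b 0 = 1 := b.one_of_mem_closedBall (by simp [b])
    rw [h3] at h2
    simpa [χ] using h2.sub_const 1
  have hωm := (memLp_of_weighted hω).1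
  have hgm := (memLp_of_weighted hg).1
  have l1 : Tendsto (fun n => eLpNorm (weighted ((fun x => χ n x * ω x) - ω)) 2 volume)
      atTop (𝓝 0) := by
    have e : ∀ n x, weighted ((fun x => χ n x * ω x) - ω) x = (χ n x - 1) * weighted ω x := by
      intro n x
      simp [weighted]
      ring
    refine tendsto_eLpNorm_two_of_dominated hω.norm (fun n => ?_) (fun n x => ?_) fun x => ?_
    · exact aestronglyMeasurable_weighted
        (((hχs n).continuous.aestronglyMeasurable.mul hωm).sub hωm)
    · rw [e, norm_mul]
      exact mul_le_of_le_one_left (norm_nonneg _) (hχ1 n x)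
    · simp_rw [e]
      simpa using (hχlim x).mul_const (weighted ω x)
  have l2 : Tendsto (fun n => eLpNorm
      (weighted ((fun x => χ n x • g x + ω x • gradient (χ n) x) - g)) 2 volume)
      atTop (𝓝 0) := by
    have e : ∀ n x, weighted ((fun x => χ n x • g x + ω x • gradient (χ n) x) - g) x =
        (χ n x - 1) • weighted g x + weighted ω x • gradient (χ n) x := by
      intro n x
      simp only [weighted, Pi.sub_apply, smul_eq_mul]
      module
    have hb : MemLp (fun x => ‖weighted g x‖ + C * ‖weighted ω x‖) 2 volume :=
      hg.norm.add (hω.norm.const_mul C)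
    refine tendsto_eLpNorm_two_of_dominated hb (fun n => ?_) (fun n x => ?_) fun x => ?_
    · exact aestronglyMeasurable_weighted
        ((((hχs n).continuous.aestronglyMeasurable.smul hgm).add (hωm.smul
          (continuous_gradient ((hχs n).of_le (by simp))).aestronglyMeasurable)).sub hgm)
    · rw [e]
      refine (norm_add_le _ _).trans (add_le_add ?_ ?_)
      · rw [norm_smul]
        exact mul_le_of_le_one_left (norm_nonneg _) (hχ1 n x)
      · rw [norm_smul, mul_comm]
        refine mul_le_mul_of_nonneg_right ((hgle n x).trans ?_) (norm_nonneg _)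
        exact mul_le_of_le_one_left hC0 (hc1 n)
    · simp_rw [e]
      have h1 := (hχlim x).smul_const (weighted g x)
      have h2 : Tendsto (fun n => gradient (χ n) x) atTop (𝓝 0) := by
        refine squeeze_zero_norm (fun n => hgle n x) ?_
        simpa using hclim.mul_const C
      simpa using h1.add (h2.const_smul (weighted ω x))
  have hpos := pos_iff_ne_zero.2 hε
  obtain ⟨n, h1, h2⟩ := ((l1.eventually_le_const hpos).and (l2.eventually_le_const hpos)).exists
  exact ⟨χ n, hχs n, hχc n, h1, h2⟩

/-- Mollification approximates compactly supported functions in the weighted norm. -/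
theorem exists_weighted_mollify_sub_le [CompleteSpace F] {h : Plane → F}
    (hh : MemLp h 2 volume) {R : ℝ} (hR : ∀ x, R < ‖x‖ → h x = 0) {ε : ℝ≥0∞} (hε : ε ≠ 0) :
    ∃ δ > 0, ∀ ρ : ContDiffBump (0 : Plane), ρ.rOut ≤ δ →
      eLpNorm (weighted (mollify volume ρ h - h)) 2 volume ≤ ε := by
  -- Once the mollification radius is at most 1, everything lives in the ball of radius R + 1, where
  -- the weight is bounded.
  obtain ⟨M, hM⟩ := ((isCompact_closedBall (0 : Plane) (R + 1)).bddAbove_image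
    continuous_sqrt_calA.continuousOn)
  have hM' : ∀ x : Plane, ‖x‖ ≤ R + 1 → √(calA x) ≤ max M 1 := fun x hx =>
    (hM ⟨x, by simpa using hx, rfl⟩).trans (le_max_left _ _)
  have hMpos : 0 < max M 1 := zero_lt_one.trans_le (le_max_right _ _)
  have hMe : ENNReal.ofReal (max M 1) ≠ 0 := (ENNReal.ofReal_pos.2 hMpos).ne'
  obtain ⟨δ, hδ, H⟩ := exists_eLpNorm_mollify_sub_le (μ := volume) hh
    (ε := ε / ENNReal.ofReal (max M 1)) (ENNReal.div_ne_zero.2 ⟨hε, ofReal_ne_top⟩)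
  refine ⟨min δ 1, lt_min hδ one_pos, fun ρ hρ => ?_⟩
  have h1 := H ρ (hρ.trans (min_le_left _ _))
  have h2 : eLpNorm (weighted (mollify volume ρ h - h)) 2 volume ≤
      ENNReal.ofReal (max M 1) * eLpNorm (mollify volume ρ h - h) 2 volume := by
    refine eLpNorm_le_mul_eLpNorm_of_ae_le_mul (.of_forall fun x => ?_) 2
    rw [norm_weighted]
    rcases le_or_gt ‖x‖ (R + 1) with hx | hx
    · exact mul_le_mul_of_nonneg_right (hM' x hx) (norm_nonneg _)
    · have e1 : mollify volume ρ h x = 0 := support_mollify_subset ρ hR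
        (by linarith [hρ.trans (min_le_right δ 1)])
      simp [e1, hR x (by linarith)]
  refine h2.trans ((mul_le_mul_right h1 _).trans ?_)
  rw [ENNReal.mul_div_cancel hMe ofReal_ne_top]

/-- Test functions are dense for the weighted Sobolev norm. -/
theorem exists_test_approx {ω : Plane → ℝ} {g : Plane → Plane} (h : HasWeakGradient ω g)
    (hω : MemLp (weighted ω) 2 volume) (hg : MemLp (weighted g) 2 volume) {ε : ℝ≥0∞}
    (hε : ε ≠ 0) :
    ∃ φ : Plane → ℝ, ContDiff ℝ 1 φ ∧ HasCompactSupport φ ∧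
      eLpNorm (weighted (φ - ω)) 2 volume ≤ ε ∧
      eLpNorm (weighted (gradient φ - g)) 2 volume ≤ ε := by
  -- The cap 1 keeps the errors finite even if ε = ∞, so the cut-off functions lie in L².
  have hε2 : min (ε / 2) 1 ≠ 0 := (lt_min (ENNReal.half_pos hε) one_pos).ne'
  obtain ⟨χ, hχ, hχc, a1, a2⟩ := exists_cutoff hω hg hε2
  have hχ1 : ContDiff ℝ 1 χ := hχ.of_le (by simp)
  have hprod := h.smooth_mul hχ
  set ω' : Plane → ℝ := fun x => χ x * ω x with hω'
  set g' : Plane → Plane := fun x => χ x • g x + ω x • gradient χ x with hg'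
  obtain ⟨R, hR0, hR⟩ := exists_support_radius hχc
  have hRg : ∀ x, R < ‖x‖ → gradient χ x = 0 := fun x hx => by
    have : χ =ᶠ[𝓝 x] fun _ => 0 := by
      filter_upwards [(isOpen_lt continuous_const continuous_norm).mem_nhds hx] with y hy
      exact hR y hy.le
    rw [gradient, this.fderiv_eq]
    simp
  have hωm := (memLp_of_weighted hω).1
  have hgm := (memLp_of_weighted hg).1
  have hω'm : AEStronglyMeasurable ω' volume := hχ.continuous.aestronglyMeasurable.mul hωm
  have hg'm : AEStronglyMeasurable g' volume := (hχ.continuous.aestronglyMeasurable.smul hgm).add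
    (hωm.smul (continuous_gradient hχ1).aestronglyMeasurable)
  have hfin : min (ε / 2) 1 < ∞ := (min_le_right _ _).trans_lt one_lt_top
  have m1 : MemLp ω' 2 volume := by
    have : MemLp (weighted (ω' - ω)) 2 volume :=
      ⟨aestronglyMeasurable_weighted (hω'm.sub hωm), a1.trans_lt hfin⟩
    simpa using (memLp_of_weighted this).add (memLp_of_weighted hω)
  have m2 : MemLp g' 2 volume := by
    have : MemLp (weighted (g' - g)) 2 volume :=
      ⟨aestronglyMeasurable_weighted (hg'm.sub hgm), a2.trans_lt hfin⟩
    simpa using (memLp_of_weighted this).add (memLp_of_weighted hg)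
  have s1 : ∀ x, R < ‖x‖ → ω' x = 0 := fun x hx => by simp [hω', hR x hx.le]
  have s2 : ∀ x, R < ‖x‖ → g' x = 0 := fun x hx => by simp [hg', hR x hx.le, hRg x hx]
  have hε3 : ε / 2 ≠ 0 := (ENNReal.half_pos hε).ne'
  obtain ⟨δ₁, hδ₁, H1⟩ := exists_weighted_mollify_sub_le m1 s1 hε3
  obtain ⟨δ₂, hδ₂, H2⟩ := exists_weighted_mollify_sub_le m2 s2 hε3
  have hδ : 0 < min δ₁ δ₂ := lt_min hδ₁ hδ₂
  let ρ : ContDiffBump (0 : Plane) := ⟨min δ₁ δ₂ / 2, min δ₁ δ₂, half_pos hδ, half_lt_self hδ⟩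
  have hcd : ContDiff ℝ 1 (mollify volume ρ ω') :=
    (contDiff_mollify ρ hprod.1).of_le (by simp)
  have hgr := gradient_mollify hprod ρ
  have hgc : Continuous (mollify volume ρ g') := hgr ▸ continuous_gradient hcd
  refine ⟨mollify volume ρ ω', hcd, ?_, ?_, ?_⟩
  · refine HasCompactSupport.intro (isCompact_closedBall 0 (R + ρ.rOut)) fun x hx => ?_
    refine support_mollify_subset ρ s1 ?_
    simpa using hx
  · have e : weighted (mollify volume ρ ω' - ω) =
        weighted (mollify volume ρ ω' - ω') + weighted (ω' - ω) := by
      rw [← weighted_add, sub_add_sub_cancel]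
    rw [e]
    refine (eLpNorm_add_le
      (aestronglyMeasurable_weighted (hcd.continuous.aestronglyMeasurable.sub hω'm))
      (aestronglyMeasurable_weighted (hω'm.sub hωm)) one_le_two).trans ?_
    calc _ ≤ ε / 2 + ε / 2 :=
          add_le_add (H1 ρ (min_le_left _ _)) (a1.trans (min_le_left _ _))
      _ = ε := ENNReal.add_halves ε
  · have e : weighted (mollify volume ρ g' - g) =
        weighted (mollify volume ρ g' - g') + weighted (g' - g) := by
      rw [← weighted_add, sub_add_sub_cancel]
    rw [hgr, e]
    refine (eLpNorm_add_le
      (aestronglyMeasurable_weighted (hgc.aestronglyMeasurable.sub hg'm))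
      (aestronglyMeasurable_weighted (hg'm.sub hgm)) one_le_two).trans ?_
    calc _ ≤ ε / 2 + ε / 2 :=
          add_le_add (H2 ρ (min_le_right _ _)) (a2.trans (min_le_left _ _))
      _ = ε := ENNReal.add_halves ε

end

/-! ### Continuity and correction of moments -/

section

open MeasureTheory Filter Topology ENNReal

theorem integral_norm_sq_eq {α F : Type*} [MeasurableSpace α] {μ : Measure α}
    [NormedAddCommGroup F] {f : α → F} (hf : MemLp f 2 μ) :
    ∫ x, ‖f x‖ ^ 2 ∂μ = (eLpNorm f 2 μ).toReal ^ 2 := by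
  have h0 : 0 ≤ ∫ x, ‖f x‖ ^ 2 ∂μ := integral_nonneg fun x => by positivity
  rw [hf.eLpNorm_eq_integral_rpow_norm two_ne_zero ofNat_ne_top]
  simp only [toReal_ofNat, Real.rpow_ofNat]
  rw [ENNReal.toReal_ofReal (Real.rpow_nonneg h0 _), ← Real.rpow_natCast, ← Real.rpow_mul h0]
  norm_num

/-- Continuity of `f ↦ ∫ ‖f‖²` under `L²` convergence. -/
theorem tendsto_integral_norm_sq {α F : Type*} [MeasurableSpace α] {μ : Measure α}
    [NormedAddCommGroup F] {f : ℕ → α → F} {u : α → F} (hf : ∀ n, MemLp (f n) 2 μ)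
    (hu : MemLp u 2 μ) (h : Tendsto (fun n => eLpNorm (f n - u) 2 μ) atTop (𝓝 0)) :
    Tendsto (fun n => ∫ x, ‖f n x‖ ^ 2 ∂μ) atTop (𝓝 (∫ x, ‖u x‖ ^ 2 ∂μ)) := by
  have h1 := ((Lp.tendsto_Lp_iff_tendsto_eLpNorm'' f hf u hu).2 h).norm.pow 2
  simpa only [Lp.norm_toLp, ← integral_norm_sq_eq (hf _), ← integral_norm_sq_eq hu] using h1

/-- Continuity of the `L²` pairing with a fixed function. -/
theorem tendsto_integral_mul_of_eLpNorm_two {α : Type*} [MeasurableSpace α] {μ : Measure α}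
    {P : α → ℝ} (hP : MemLp P 2 μ) {f : ℕ → α → ℝ} {u : α → ℝ} (hf : ∀ n, MemLp (f n) 2 μ)
    (hu : MemLp u 2 μ) (h : Tendsto (fun n => eLpNorm (f n - u) 2 μ) atTop (𝓝 0)) :
    Tendsto (fun n => ∫ x, P x * f n x ∂μ) atTop (𝓝 (∫ x, P x * u x ∂μ)) := by
  refine tendsto_integral_of_L1' (fun x => P x * u x) (hP.integrable_mul hu).1
    (.of_forall fun n => hP.integrable_mul (hf n)) ?_
  have hlim : Tendsto (fun n => eLpNorm P 2 μ * eLpNorm (f n - u) 2 μ) atTop (𝓝 0) := by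
    simpa using ENNReal.Tendsto.const_mul h (Or.inr hP.eLpNorm_ne_top)
  refine tendsto_of_tendsto_of_tendsto_of_le_of_le tendsto_const_nhds hlim (fun n => zero_le)
    fun n => ?_
  have := eLpNorm_smul_le_mul_eLpNorm (p := 2) (q := 2) (r := 1) ((hf n).sub hu).1 hP.1
  refine (Eq.le ?_).trans this
  congr 1
  ext x
  simp [mul_sub]

/-- The weight `𝒜` grows faster than any polynomial; degree six suffices here. -/
theorem one_add_norm_pow_le_calA (x : Plane) : (1 + ‖x‖) ^ 6 ≤ 12288 * calA x := by
  set s : ℝ := ‖x‖ ^ 2 / 4 with hs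
  have hs0 : 0 ≤ s := by positivity
  have h1 : (1 + ‖x‖) ^ 2 ≤ 8 * (1 + s) := by
    rw [hs]
    nlinarith [sq_nonneg (‖x‖ - 1)]
  have h2 : ((1 + ‖x‖) ^ 2) ^ 3 ≤ (8 * (1 + s)) ^ 3 := pow_le_pow_left₀ (by positivity) h1 3
  have h3 := profA_cubic_le hs0
  rw [calA_eq_profA, ← hs]
  have h4 : 0 ≤ s ^ 2 := by positivity
  -- The constant is 12288 = 24 · 8³, matching the cubic coefficient 1/24.
  calc (1 + ‖x‖) ^ 6 = ((1 + ‖x‖) ^ 2) ^ 3 := by ring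
    _ ≤ (8 * (1 + s)) ^ 3 := h2
    _ ≤ 12288 * (1 + s / 2 + s ^ 2 / 6 + s ^ 3 / 24) := by nlinarith
    _ ≤ 12288 * profA s := by linarith

/-- p²/𝒜 is bounded by a multiple of (1 + |x|)⁻⁴, integrable in dimension two. Moments thus become
L² pairings of √𝒜 ω with p/√𝒜. -/
theorem memLp_div_sqrt_calA {p : Plane → ℝ} (hp : Continuous p) (hle : ∀ x, |p x| ≤ 1 + ‖x‖) :
    MemLp (fun x => p x / √(calA x)) 2 volume := by
  have hc : Continuous fun x => p x / √(calA x) :=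
    hp.div continuous_sqrt_calA fun x => (zero_lt_one.trans_le (one_le_sqrt_calA x)).ne'
  rw [memLp_two_iff_integrable_sq hc.aestronglyMeasurable]
  have hi : Integrable (fun x : Plane => 12288 * (1 + ‖x‖) ^ (-(4 : ℝ))) :=
    (integrable_one_add_norm (by simp; norm_num)).const_mul _
  refine hi.mono' (hc.pow 2).aestronglyMeasurable (.of_forall fun x => ?_)
  have hA := calA_pos x
  have hr : 0 < 1 + ‖x‖ := by positivity
  have h1 : p x ^ 2 ≤ (1 + ‖x‖) ^ 2 := sq_le_sq.2 ((hle x).trans (le_abs_self _))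
  have e : (1 + ‖x‖) ^ (-(4 : ℝ)) = ((1 + ‖x‖) ^ 4)⁻¹ := by
    rw [Real.rpow_neg hr.le]
    norm_cast
  rw [Real.norm_of_nonneg (by positivity), div_pow, Real.sq_sqrt hA.le, e, div_le_iff₀ hA,
    mul_assoc, mul_comm _ (calA x), ← mul_assoc, ← div_eq_mul_inv, le_div_iff₀ (by positivity)]
  calc p x ^ 2 * (1 + ‖x‖) ^ 4 ≤ (1 + ‖x‖) ^ 2 * (1 + ‖x‖) ^ 4 := by gcongr
    _ = (1 + ‖x‖) ^ 6 := by ring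
    _ ≤ _ := one_add_norm_pow_le_calA x

/-- The moments against functions of linear growth are continuous in the weighted norm. -/
theorem tendsto_moment {p : Plane → ℝ} (hp : Continuous p) (hle : ∀ x, |p x| ≤ 1 + ‖x‖)
    {φ : ℕ → Plane → ℝ} {ω : Plane → ℝ} (hφ : ∀ n, MemLp (weighted (φ n)) 2 volume)
    (hω : MemLp (weighted ω) 2 volume)
    (h : Tendsto (fun n => eLpNorm (weighted (φ n - ω)) 2 volume) atTop (𝓝 0)) :
    Tendsto (fun n => ∫ x, p x * φ n x) atTop (𝓝 (∫ x, p x * ω x)) := by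
  simp_rw [weighted_sub] at h
  have e : ∀ k : Plane → ℝ, ∀ x, p x / √(calA x) * weighted k x = p x * k x := fun k x => by
    have := (zero_lt_one.trans_le (one_le_sqrt_calA x)).ne'
    rw [weighted, smul_eq_mul]
    field_simp
  simpa only [e] using tendsto_integral_mul_of_eLpNorm_two (memLp_div_sqrt_calA hp hle) hφ hω h

theorem abs_apply_le_one_add_norm (x : Plane) (j : Fin 2) : |x j| ≤ 1 + ‖x‖ := by
  have := PiLp.norm_apply_le x j
  rw [Real.norm_eq_abs] at this
  linarith

/-- A normalized bump works: it is even, so its first moments vanish. -/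
theorem exists_unit_mass : ∃ η : Plane → ℝ, ContDiff ℝ ((⊤ : ℕ∞) : WithTop ℕ∞) η ∧
    HasCompactSupport η ∧ ∫ x, η x = 1 ∧ ∀ i : Fin 2, ∫ x, x i * η x = 0 := by
  let ρ : ContDiffBump (0 : Plane) := ⟨1, 2, one_pos, one_lt_two⟩
  refine ⟨ρ.normed volume, ρ.contDiff_normed, ρ.hasCompactSupport_normed, ρ.integral_normed,
    fun i => ?_⟩
  have h := integral_neg_eq_self (fun x : Plane => x i * ρ.normed volume x) volume
  simp only [ρ.normed_neg, PiLp.neg_apply, neg_mul, integral_neg] at h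
  linarith

/-- Take -∂ⱼρ for a bump ρ of mass one and integrate by parts against 1 and xᵢ. -/
theorem exists_unit_moment (j : Fin 2) : ∃ η : Plane → ℝ, ContDiff ℝ 1 η ∧
    HasCompactSupport η ∧ ∫ x, η x = 0 ∧ ∀ i : Fin 2, ∫ x, x i * η x = if i = j then 1 else 0 := by
  obtain ⟨ρ, hρ, hρc, hmass, -⟩ := exists_unit_mass
  have hρ1 : ContDiff ℝ 1 ρ := hρ.of_le (by simp)
  set e : Plane := EuclideanSpace.single j 1 with he
  have hd : ContDiff ℝ 1 fun x => fderiv ℝ ρ x e :=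
    (hρ.fderiv_right (m := 1) (by norm_cast)).clm_apply contDiff_const
  have hdc : HasCompactSupport fun x => fderiv ℝ ρ x e := hρc.fderiv_apply ℝ e
  have key : ∀ f : Plane → ℝ, ContDiff ℝ 1 f →
      ∫ x, f x * -fderiv ℝ ρ x e = ∫ x, fderiv ℝ f x e * ρ x := fun f hf => by
    have hfd : Continuous fun x => fderiv ℝ f x e := by
      have := hf.continuous_fderiv one_ne_zero
      fun_prop
    simp only [mul_neg, integral_neg]
    rw [integral_mul_fderiv_eq_neg_fderiv_mul_of_integrable, neg_neg]
    · exact (hfd.mul hρ.continuous).integrable_of_hasCompactSupport hρc.mul_left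
    · exact (hf.continuous.mul hd.continuous).integrable_of_hasCompactSupport hdc.mul_left
    · exact (hf.continuous.mul hρ.continuous).integrable_of_hasCompactSupport hρc.mul_left
    · exact fun x _ => hf.differentiable one_ne_zero x
    · exact fun x _ => hρ1.differentiable one_ne_zero x
  refine ⟨fun x => -fderiv ℝ ρ x e, hd.neg, hdc.neg, ?_, fun i => ?_⟩
  · simpa using key (fun _ => 1) contDiff_const
  · have hf : ∀ x, fderiv ℝ (fun y : Plane => y i) x e = if i = j then 1 else 0 := fun x => by
      have : (fun y : Plane => y i) = EuclideanSpace.proj (𝕜 := ℝ) i := rfl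
      rw [this, ContinuousLinearMap.fderiv]
      simp [he]
    have hk := key (fun y => y i) (EuclideanSpace.proj (𝕜 := ℝ) i).contDiff
    simpa only [hf, integral_const_mul, hmass, mul_one] using hk

/-- A sequence of test functions converging to `ω` together with its gradients, `g` being the
limit of the gradients, in the norms weighted with `𝒜`. -/
structure IsTestApprox (φ : ℕ → Plane → ℝ) (ω : Plane → ℝ) (g : Plane → Plane) : Prop where
  contDiff : ∀ n, ContDiff ℝ 1 (φ n)
  hasCompactSupport : ∀ n, HasCompactSupport (φ n)
  tendsto : Tendsto (fun n => eLpNorm (weighted (φ n - ω)) 2 volume) atTop (𝓝 0)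
  tendsto_gradient :
    Tendsto (fun n => eLpNorm (weighted (gradient (φ n) - g)) 2 volume) atTop (𝓝 0)

theorem hasCompactSupport_gradient {φ : Plane → ℝ} (hc : HasCompactSupport φ) :
    HasCompactSupport (gradient φ) :=
  (hc.fderiv ℝ).comp_left (map_zero (InnerProductSpace.toDual ℝ Plane).symm)

theorem IsTestApprox.memLp {φ : ℕ → Plane → ℝ} {ω : Plane → ℝ} {g : Plane → Plane}
    (h : IsTestApprox φ ω g) (n : ℕ) : MemLp (weighted (φ n)) 2 volume :=
  memLp_weighted_of_hasCompactSupport (h.contDiff n).continuous (h.hasCompactSupport n)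

theorem IsTestApprox.memLp_gradient {φ : ℕ → Plane → ℝ} {ω : Plane → ℝ} {g : Plane → Plane}
    (h : IsTestApprox φ ω g) (n : ℕ) : MemLp (weighted (gradient (φ n))) 2 volume :=
  memLp_weighted_of_hasCompactSupport (continuous_gradient (h.contDiff n))
    (hasCompactSupport_gradient (h.hasCompactSupport n))

theorem exists_isTestApprox {ω : Plane → ℝ} {g : Plane → Plane} (h : HasWeakGradient ω g)
    (hω : MemLp (weighted ω) 2 volume) (hg : MemLp (weighted g) 2 volume) :
    ∃ φ, IsTestApprox φ ω g := by
  -- At n = 0 the inverse is ∞, a harmless tolerance.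
  have hne : ∀ n : ℕ, ((n : ℝ≥0∞))⁻¹ ≠ 0 := fun n => by simp
  choose φ h1 h2 h3 h4 using fun n : ℕ => exists_test_approx h hω hg (hne n)
  exact ⟨φ, h1, h2,
    tendsto_of_tendsto_of_tendsto_of_le_of_le tendsto_const_nhds
      ENNReal.tendsto_inv_nat_nhds_zero (fun _ => zero_le) h3,
    tendsto_of_tendsto_of_tendsto_of_le_of_le tendsto_const_nhds
      ENNReal.tendsto_inv_nat_nhds_zero (fun _ => zero_le) h4⟩

theorem tendsto_eLpNorm_weighted_sub_smul {F : Type*} [NormedAddCommGroup F] [NormedSpace ℝ F]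
    {h : ℕ → Plane → F} {u k : Plane → F} {c : ℕ → ℝ}
    (hm : ∀ n, AEStronglyMeasurable (h n - u) volume) (hk : MemLp (weighted k) 2 volume)
    (hc : Tendsto c atTop (𝓝 0))
    (hu : Tendsto (fun n => eLpNorm (weighted (h n - u)) 2 volume) atTop (𝓝 0)) :
    Tendsto (fun n => eLpNorm (weighted (h n - c n • k - u)) 2 volume) atTop (𝓝 0) := by
  have hce : Tendsto (fun n => ‖c n‖ₑ * eLpNorm (weighted k) 2 volume) atTop (𝓝 0) := by
    simpa using ENNReal.Tendsto.mul_const (tendsto_zero_iff_enorm_tendsto_zero.1 hc)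
      (Or.inr hk.eLpNorm_ne_top)
  refine tendsto_of_tendsto_of_tendsto_of_le_of_le tendsto_const_nhds
    (by simpa using hu.add hce) (fun _ => zero_le) fun n => ?_
  have e : weighted (h n - c n • k - u) = weighted (h n - u) - c n • weighted k := by
    rw [← weighted_const_smul, ← weighted_sub, sub_right_comm]
  change eLpNorm (weighted (h n - c n • k - u)) 2 volume ≤ _
  rw [e, ← eLpNorm_const_smul]
  exact eLpNorm_sub_le (aestronglyMeasurable_weighted (hm n)) (hk.1.const_smul _) one_le_two

theorem IsTestApprox.sub_smul {φ : ℕ → Plane → ℝ} {ω η : Plane → ℝ} {g : Plane → Plane}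
    (h : IsTestApprox φ ω g) (hω : MemLp (weighted ω) 2 volume)
    (hg : MemLp (weighted g) 2 volume) (hη : ContDiff ℝ 1 η) (hηc : HasCompactSupport η)
    {c : ℕ → ℝ} (hc : Tendsto c atTop (𝓝 0)) :
    IsTestApprox (fun n => φ n - c n • η) ω g where
  contDiff n := (h.contDiff n).sub (hη.const_smul (c n))
  hasCompactSupport n := (h.hasCompactSupport n).sub (hηc.smul_left (f := fun _ => c n))
  tendsto := tendsto_eLpNorm_weighted_sub_smul
    (fun n => (h.contDiff n).continuous.aestronglyMeasurable.sub (memLp_of_weighted hω).1)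
    (memLp_weighted_of_hasCompactSupport hη.continuous hηc) hc h.tendsto
  tendsto_gradient := by
    have e : ∀ n, gradient (φ n - c n • η) = gradient (φ n) - c n • gradient η := fun n => by
      ext1 x
      have hd := hη.differentiable one_ne_zero x
      simp [gradient, fderiv_sub ((h.contDiff n).differentiable one_ne_zero x)
        (hd.const_smul (c n)), fderiv_const_smul hd]
    simp_rw [e]
    exact tendsto_eLpNorm_weighted_sub_smul
      (fun n => (continuous_gradient (h.contDiff n)).aestronglyMeasurable.sub
        (memLp_of_weighted hg).1)
      (memLp_weighted_of_hasCompactSupport (continuous_gradient hη)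
        (hasCompactSupport_gradient hηc)) hc h.tendsto_gradient

/-- Functions with vanishing moments are approximated by test functions with vanishing moments. -/
theorem exists_isTestApprox_moments {ω : Plane → ℝ} {g : Plane → Plane}
    (h : HasWeakGradient ω g) (hω : MemLp (weighted ω) 2 volume)
    (hg : MemLp (weighted g) 2 volume) (h0 : ∫ x, ω x = 0)
    (h1 : ∀ j : Fin 2, ∫ x, x j * ω x = 0) :
    ∃ φ, IsTestApprox φ ω g ∧ ∀ n, ∫ x, φ n x = 0 ∧ ∀ j : Fin 2, ∫ x, x j * φ n x = 0 := by
  obtain ⟨φ, hφ⟩ := exists_isTestApprox h hω hg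
  obtain ⟨η, hη, hηc, hη0, hη1⟩ := exists_unit_mass
  choose ξ hξ hξc hξ0 hξ1 using exists_unit_moment
  have hη' : ContDiff ℝ 1 η := hη.of_le (by simp)
  have t0 : Tendsto (fun n => ∫ x, φ n x) atTop (𝓝 0) := by
    simpa [h0] using tendsto_moment (p := fun _ => 1) continuous_const
      (fun x => by simp) hφ.memLp hω hφ.tendsto
  have t1 : ∀ j : Fin 2, Tendsto (fun n => ∫ x, x j * φ n x) atTop (𝓝 0) := fun j => by
    simpa [h1] using tendsto_moment (p := fun x => x j) (by fun_prop)
      (fun x => abs_apply_le_one_add_norm x j) hφ.memLp hω hφ.tendsto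
  -- The three correctors are dual to the moments, so the coefficients are the moments of the
  -- uncorrected φₙ, which tend to zero.
  refine ⟨_, ((hφ.sub_smul hω hg hη' hηc t0).sub_smul hω hg (hξ 0) (hξc 0) (t1 0)).sub_smul
    hω hg (hξ 1) (hξc 1) (t1 1), fun n => ?_⟩
  have key : ∀ p : Plane → ℝ, Continuous p → ∀ a b c : ℝ,
      ∫ x, p x * (φ n - a • η - b • ξ 0 - c • ξ 1) x = (∫ x, p x * φ n x) -
        a * (∫ x, p x * η x) - b * (∫ x, p x * ξ 0 x) - c * ∫ x, p x * ξ 1 x := by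
    intro p hp a b c
    have i : ∀ k : Plane → ℝ, Continuous k → HasCompactSupport k →
        Integrable fun x => p x * k x := fun k hk hkc =>
      (hp.mul hk).integrable_of_hasCompactSupport hkc.mul_left
    have i0 := i _ (hφ.contDiff n).continuous (hφ.hasCompactSupport n)
    have i1 := (i _ hη.continuous hηc).const_mul a
    have i2 := (i _ (hξ 0).continuous (hξc 0)).const_mul b
    have i3 := (i _ (hξ 1).continuous (hξc 1)).const_mul c
    simp_rw [← integral_const_mul]
    have i01 : Integrable fun x => p x * φ n x - a * (p x * η x) := i0.sub i1
    have i012 : Integrable fun x => p x * φ n x - a * (p x * η x) - b * (p x * ξ 0 x) := i01.sub i2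
    rw [← integral_sub i0 i1, ← integral_sub i01 i2, ← integral_sub i012 i3]
    refine integral_congr_ae (.of_forall fun x => ?_)
    simp
    ring
  refine ⟨?_, fun j => ?_⟩
  · have := key (fun _ => 1) continuous_const (∫ x, φ n x) (∫ x, x 0 * φ n x) (∫ x, x 1 * φ n x)
    simp only [one_mul, hη0, hξ0] at this
    rw [this]
    ring
  · rw [key (fun x => x j) (by fun_prop)]
    fin_cases j <;> simp [hη1, hξ1]

end

/-! ### Passage to the limit in the quadratic form -/

section

open MeasureTheory Filter Topology ENNReal

theorem norm_sq_weighted {F : Type*} [NormedAddCommGroup F] [NormedSpace ℝ F] (h : Plane → F)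
    (x : Plane) : ‖weighted h x‖ ^ 2 = calA x * ‖h x‖ ^ 2 := by
  rw [norm_weighted, mul_pow, Real.sq_sqrt (calA_pos x).le]

theorem aestronglyMeasurable_sqrt_calB_mul {h : Plane → ℝ} (hh : AEStronglyMeasurable h volume) :
    AEStronglyMeasurable (fun x => √(calB x) * h x) volume :=
  (Real.continuous_sqrt.measurable.comp_aemeasurable aemeasurable_calB).aestronglyMeasurable.mul hh

theorem sqrt_calB_le {x : Plane} (hx : x ≠ 0) : √(calB x) ≤ 2 * √(calA x) := by
  have h : √(calB x) ≤ √(2 ^ 2 * calA x) := by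
    refine Real.sqrt_le_sqrt ((calB_le hx).trans ?_)
    linarith [calA_pos x]
  rwa [Real.sqrt_mul (by norm_num), Real.sqrt_sq (by norm_num)] at h

theorem norm_sqrt_calB_mul_le (h : Plane → ℝ) :
    ∀ᵐ x, ‖√(calB x) * h x‖ ≤ 2 * ‖weighted h x‖ := by
  filter_upwards [ae_ne_zero] with x hx
  rw [norm_mul, Real.norm_of_nonneg (Real.sqrt_nonneg _), norm_weighted, ← mul_assoc]
  exact mul_le_mul_of_nonneg_right (sqrt_calB_le hx) (norm_nonneg _)

theorem memLp_sqrt_calB_mul {h : Plane → ℝ} (hh : MemLp (weighted h) 2 volume) :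
    MemLp (fun x => √(calB x) * h x) 2 volume :=
  hh.of_le_mul (aestronglyMeasurable_sqrt_calB_mul (memLp_of_weighted hh).1)
    (norm_sqrt_calB_mul_le h)

/-- Exhibits Q as a difference of two squared L² norms, each continuous in the weighted norms. -/
theorem densityQ_ae_eq (ω : Plane → ℝ) (g : Plane → Plane) : densityQ ω g =ᵐ[volume]
    fun x => ‖weighted g x‖ ^ 2 - ‖√(calB x) * ω x‖ ^ 2 := by
  filter_upwards [ae_ne_zero] with x hx
  rw [densityQ, norm_sq_weighted, Real.norm_eq_abs, sq_abs, mul_pow, Real.sq_sqrt (calB_nonneg hx)]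

theorem integrable_norm_sq_of_memLp {α F : Type*} [MeasurableSpace α] {μ : Measure α}
    [NormedAddCommGroup F] {f : α → F} (hf : MemLp f 2 μ) : Integrable (fun x => ‖f x‖ ^ 2) μ :=
  (memLp_two_iff_integrable_sq_norm hf.1).1 hf

theorem integrable_densityQ {ω : Plane → ℝ} {g : Plane → Plane}
    (hω : MemLp (weighted ω) 2 volume) (hg : MemLp (weighted g) 2 volume) :
    Integrable (densityQ ω g) :=
  ((integrable_norm_sq_of_memLp hg).sub
    (integrable_norm_sq_of_memLp (memLp_sqrt_calB_mul hω))).congr (densityQ_ae_eq ω g).symm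

theorem formQ_eq {ω : Plane → ℝ} {g : Plane → Plane}
    (hω : MemLp (weighted ω) 2 volume) (hg : MemLp (weighted g) 2 volume) :
    formQ ω g = (∫ x, ‖weighted g x‖ ^ 2) - ∫ x, ‖√(calB x) * ω x‖ ^ 2 := by
  rw [formQ, integral_congr_ae (densityQ_ae_eq ω g), integral_sub (integrable_norm_sq_of_memLp hg)
    (integrable_norm_sq_of_memLp (memLp_sqrt_calB_mul hω))]

theorem normXSq_eq (ω : Plane → ℝ) : normXSq ω = ∫ x, ‖weighted ω x‖ ^ 2 := by
  refine integral_congr_ae (.of_forall fun x => ?_)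
  change _ = ‖weighted ω x‖ ^ 2
  rw [norm_sq_weighted, Real.norm_eq_abs, sq_abs]

/-- The coercivity estimate for test functions with vanishing moments. -/
theorem normXSq_le_formQ_gradient {φ : Plane → ℝ} (hφ : ContDiff ℝ 1 φ) (hc : HasCompactSupport φ)
    (h0 : ∫ x, φ x = 0) (h1 : ∀ j : Fin 2, ∫ x, x j * φ x = 0) :
    1 / 1000 * normXSq φ ≤ formQ φ (gradient φ) := by
  have hω : MemLp (weighted φ) 2 volume := memLp_weighted_of_hasCompactSupport hφ.continuous hc
  have hg : MemLp (weighted (gradient φ)) 2 volume :=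
    memLp_weighted_of_hasCompactSupport (continuous_gradient hφ) (hasCompactSupport_gradient hc)
  have h := integral_coerciveDensity_nonneg hφ hc h0 h1
  have e : coerciveDensity φ =ᵐ[volume]
      fun x => densityQ φ (gradient φ) x - 1 / 1000 * ‖weighted φ x‖ ^ 2 := by
    filter_upwards [ae_ne_zero] with x hx
    rw [coerciveDensity, densityQ, norm_sq_weighted, calA_eq_profA, calB_eq_profB hx,
      Real.norm_eq_abs, sq_abs]
    ring
  rw [integral_congr_ae e, integral_sub (integrable_densityQ hω hg)
    ((integrable_norm_sq_of_memLp hω).const_mul _), integral_const_mul, ← normXSq_eq] at h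
  rw [formQ]
  linarith

/-- The coercivity estimate in the weighted Sobolev space. -/
theorem normXSq_le_formQ {ω : Plane → ℝ} {g : Plane → Plane} (h : HasWeakGradient ω g)
    (hω : MemLp (weighted ω) 2 volume) (hg : MemLp (weighted g) 2 volume) (h0 : ∫ x, ω x = 0)
    (h1 : ∀ j : Fin 2, ∫ x, x j * ω x = 0) : 1 / 1000 * normXSq ω ≤ formQ ω g := by
  obtain ⟨φ, hφ, hmom⟩ := exists_isTestApprox_moments h hω hg h0 h1
  have tA : Tendsto (fun n => normXSq (φ n)) atTop (𝓝 (normXSq ω)) := by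
    simp_rw [normXSq_eq]
    exact tendsto_integral_norm_sq hφ.memLp hω (by simpa only [weighted_sub] using hφ.tendsto)
  have tG : Tendsto (fun n => ∫ x, ‖weighted (gradient (φ n)) x‖ ^ 2) atTop
      (𝓝 (∫ x, ‖weighted g x‖ ^ 2)) :=
    tendsto_integral_norm_sq hφ.memLp_gradient hg
      (by simpa only [weighted_sub] using hφ.tendsto_gradient)
  have tB : Tendsto (fun n => ∫ x, ‖√(calB x) * φ n x‖ ^ 2) atTop
      (𝓝 (∫ x, ‖√(calB x) * ω x‖ ^ 2)) := by
    refine tendsto_integral_norm_sq (fun n => memLp_sqrt_calB_mul (hφ.memLp n))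
      (memLp_sqrt_calB_mul hω) ?_
    have hlim : Tendsto (fun n => ENNReal.ofReal 2 * eLpNorm (weighted (φ n - ω)) 2 volume) atTop
        (𝓝 0) := by
      simpa only [mul_zero] using
        ENNReal.Tendsto.const_mul (a := ENNReal.ofReal 2) hφ.tendsto (Or.inr ofReal_ne_top)
    refine tendsto_of_tendsto_of_tendsto_of_le_of_le tendsto_const_nhds hlim (fun _ => zero_le)
      fun n => eLpNorm_le_mul_eLpNorm_of_ae_le_mul ?_ 2
    filter_upwards [norm_sqrt_calB_mul_le (φ n - ω)] with x hx
    simpa [mul_sub] using hx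
  rw [formQ_eq hω hg]
  refine le_of_tendsto_of_tendsto' (tA.const_mul _) (tG.sub tB) fun n => ?_
  rw [← formQ_eq (hφ.memLp n) (hφ.memLp_gradient n)]
  exact normXSq_le_formQ_gradient (hφ.contDiff n) (hφ.hasCompactSupport n) (hmom n).1 (hmom n).2

end

end OseenVortex

end

theorem theorem4p2 :
    ∃ δ : ℝ, 0 < δ ∧
      ∀ ω ∈ OseenVortex.spaceZ ∩ OseenVortex.momentSpace,
        ∀ g : OseenVortex.Plane → OseenVortex.Plane, OseenVortex.HasWeakGradient ω g →
          MeasureTheory.Integrable (OseenVortex.densityQ ω g) MeasureTheory.volume ∧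
            δ * OseenVortex.normXSq ω ≤ OseenVortex.formQ ω g := by
  refine ⟨1 / 1000, by norm_num, fun ω hω g hg => ?_⟩
  obtain ⟨⟨-, hA, g', hg', -, hAg'⟩, -, h0, h1⟩ := hω
  -- Membership in Z controls only some weak gradient g'; uniqueness transfers the weighted bound to
  -- the given g.
  have hAg : MeasureTheory.MemLp (OseenVortex.weighted g) 2 MeasureTheory.volume :=
    hAg'.ae_eq <| (hg'.ae_eq hg).mono fun x hx => by simp [OseenVortex.weighted, hx]
  exact ⟨OseenVortex.integrable_densityQ hA hAg, OseenVortex.normXSq_le_formQ hg hA hAg h0 h1⟩
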